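/- **Setting.** Let $m\ge 2$, let $\mathbb Z_m=\mathbb Z/m\mathbb Z$ be identified with $\{0<1<\dots<m-1\}$, and let $(n_s)_{s\in\mathbb Z_m}$, $(d_s)_{s\in\mathbb Z_m}$ be families of non-negative integers, $|\mathbf d|=\sum_s d_s$. Let $\mathcal M^\bullet$ be the affine complex variety of tuples of matrices $$X_s\in \mathrm{Mat}(n_s\times n_{s+1},\mathbb C),\quad Y_s\in \mathrm{Mat}(n_{s+1}\times n_s,\mathbb C),\quad V_{s,\alpha}\in \mathrm{Mat}(1\times n_s,\mathbb C),\quad W_{s,\alpha}\in \mathrm{Mat}(n_s\times 1,\mathbb C)$$ ($s\in\mathbb Z_m$, $1\le\alpha\le d_s$) such that all of $\mathrm{Id}+X_sY_s$, $\mathrm{Id}+Y_sX_s$, $\mathrm{Id}+W_{s,\alpha}V_{s,\alpha}$, $1+V_{s,\alpha}W_{s,\alpha}$ are invertible. Its coordinate ring $\mathbb C[\mathcal M^\bullet]$ (the polynomial ring in the matrix entries, localized at the corresponding determinants) carries the quasi-Poisson bracket, namely the antisymmetric $\mathbb C$-bilinear biderivation $\{-,-\}$ determined by the following values on matrix entries.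 Here $\delta$ is the Kronecker delta, where a delta of two row or column indices is $1$ exactly when the two indices belong to the same vertex and are equal; $o(a,b)$ is $+1$ if $a<b$, $-1$ if $a>b$ and $0$ if $a=b$; and a term with a factor $\delta_{sr}$ (or $\delta_{(s,r\pm1)}$) is omitted when that factor is $0$. $$\{(X_r)_{ij},(X_s)_{kl}\}=\tfrac12\delta_{(s,r-1)}(X_{r-1}X_r)_{kj}\delta_{il}-\tfrac12\delta_{(s,r+1)}\delta_{kj}(X_rX_{r+1})_{il},$$ $$\{(Y_r)_{ij},(Y_s)_{kl}\}=\tfrac12\delta_{(s,r-1)}\delta_{kj}(Y_rY_{r-1})_{il}-\tfrac12\delta_{(s,r+1)}(Y_{r+1}Y_r)_{kj}\delta_{il},$$ $$\{(X_r)_{ij},(Y_s)_{kl}\}=\delta_{sr}\big(\delta_{kj}\delta_{il}+\tfrac12(Y_rX_r)_{kj}\delta_{il}+\tfrac12\delta_{kj}(X_rY_r)_{il}\big)-\tfrac12\delta_{(s,r-1)}(X_r)_{kj}(Y_{r-1})_{il}+\tfrac12\delta_{(s,r+1)}(Y_{r+1})_{kj}(X_r)_{il},$$ $$\{(X_r)_{ij},(W_{s,\alpha})_k\}=\tfrac12\delta_{(s,r+1)}\delta_{kj}(X_rW_{s,\alpha})_i-\tfrac12\delta_{rs}(X_r)_{kj}(W_{s,\alpha})_i,$$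 $$\{(X_r)_{ij},(V_{s,\alpha})_l\}=\tfrac12\delta_{rs}(V_{s,\alpha}X_r)_j\delta_{il}-\tfrac12\delta_{(s,r+1)}(V_{s,\alpha})_j(X_r)_{il},$$ $$\{(Y_r)_{ij},(W_{s,\alpha})_k\}=\tfrac12\delta_{rs}\delta_{kj}(Y_rW_{s,\alpha})_i-\tfrac12\delta_{(s,r+1)}(Y_r)_{kj}(W_{s,\alpha})_i,$$ $$\{(Y_r)_{ij},(V_{s,\alpha})_l\}=\tfrac12\delta_{(s,r+1)}(V_{s,\alpha}Y_r)_j\delta_{il}-\tfrac12\delta_{rs}(V_{s,\alpha})_j(Y_r)_{il},$$ $$\{(V_{s,\alpha})_j,(V_{r,\beta})_l\}=-\tfrac12 o(s,r)(V_{s,\alpha})_j(V_{r,\beta})_l-\tfrac12\delta_{sr}o(\alpha,\beta)\big((V_{r,\beta})_j(V_{s,\alpha})_l+(V_{s,\alpha})_j(V_{r,\beta})_l\big),$$ $$\{(W_{s,\alpha})_i,(W_{r,\beta})_k\}=-\tfrac12 o(s,r)(W_{r,\beta})_k(W_{s,\alpha})_i-\tfrac12\delta_{sr}o(\alpha,\beta)\big((W_{r,\beta})_k(W_{s,\alpha})_i+(W_{s,\alpha})_k(W_{r,\beta})_i\big),$$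 $$\begin{aligned}\{(V_{s,\alpha})_j,(W_{r,\beta})_k\}=\ &\tfrac12 o(s,r)(W_{r,\beta})_k(V_{s,\alpha})_j+\delta_{sr}\delta_{\alpha\beta}\big(\delta_{kj}+\tfrac12(W_{r,\beta})_k(V_{s,\alpha})_j+\tfrac12\delta_{kj}(V_{s,\alpha}W_{r,\beta})\big)\\&+\tfrac12\delta_{sr}o(\alpha,\beta)\big(\delta_{kj}(V_{s,\alpha}W_{r,\beta})+(W_{r,\beta})_k(V_{s,\alpha})_j\big).\end{aligned}$$ Let $\rho$ be the increasing enumeration, by $\{1,\dots,|\mathbf d|\}$, of the pairs $(s,\alpha)$ ($s\in\mathbb Z_m$, $1\le\alpha\le d_s$) in lexicographic order. Define matrices of regular functions on $\mathcal M^\bullet$ by $$\Phi^{(0)}_s=(\mathrm{Id}_{n_s}+X_sY_s)(\mathrm{Id}_{n_s}+Y_{s-1}X_{s-1})^{-1},$$ and, for $1\le b\le|\mathbf d|$, $\Phi^{(b)}_s=\Phi^{(b-1)}_s(\mathrm{Id}_{n_s}+W_{\rho(b)}V_{\rho(b)})^{-1}$ if $\rho(b)=(s,\alpha)$ for some $\alpha$,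 and $\Phi^{(b)}_s=\Phi^{(b-1)}_s$ otherwise. Put $T_s=\mathrm{Id}_{n_s}+X_sY_s$. On $\bigoplus_s\mathbb C^{n_s}$ put $X=\sum_sX_s$, $Y=\sum_sY_s$ and $\Phi^{(b)}=\sum_s\Phi_s^{(b)}$ (block diagonal). Let $$\mathcal L_+=\mathbb C\big[\mathrm{tr}\big((\Phi_s^{(b)}T_s^{-1})^k\big)\;\big|\;k\ge0,\ s\in\mathbb Z_m,\ 0\le b\le|\mathbf d|\big],$$ $$\mathcal L_+^{\mathrm{cyc}}=\mathbb C\big[\mathrm{tr}\big((\Phi^{(b)}(1+XY)^{-1})^k\big)\;\big|\;k\ge0,\ 0\le b\le|\mathbf d|\big]$$ be the subalgebras of $\mathbb C[\mathcal M^\bullet]$ generated by these functions. **Proposition 3.11.** $\mathcal L_+$ and $\mathcal L_+^{\mathrm{cyc}}$ are abelian Poisson algebras for the restriction of $\{-,-\}$: each of them is closed under the bracket, the bracket restricted to it is antisymmetric and satisfies the Jacobi identity, and it vanishes identically, $\{f,g\}=0$ for all $f,g$ in the algebra. -/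

import Mathlib

open scoped Matrix

namespace CyclicQuiver

/-! Vertices of the cyclic quiver are the elements of `Fin m`, with its addition modulo `m` and its
usual total order `0 < 1 < ... < m - 1`. The framing vertex `∞` has dimension `1`, the vertex `s`
has dimension `n s`, and there are `d s` arrows `∞ ⟶ s`. -/

/-- The coordinates on the representation space: the matrix entries `(X_s)_{ij}`, `(Y_s)_{ij}`,
`(V_{s,α})_j`, `(W_{s,α})_i`, where `X_s` has size `n_s × n_{s+1}`, `Y_s` has size `n_{s+1} × n_s`,
`V_{s,α}` is a row and `W_{s,α}` a column of length `n_s`. -/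
inductive Coord {m : ℕ} [NeZero m] (n d : Fin m → ℕ) : Type
  | x (s : Fin m) (i : Fin (n s)) (j : Fin (n (s + 1))) : Coord n d
  | y (s : Fin m) (i : Fin (n (s + 1))) (j : Fin (n s)) : Coord n d
  | v (s : Fin m) (α : Fin (d s)) (j : Fin (n s)) : Coord n d
  | w (s : Fin m) (α : Fin (d s)) (i : Fin (n s)) : Coord n d
  deriving DecidableEq, Fintype

/-- Index set of a basis of `V_cyc = ⨁ s, ℂ^{n_s}`. -/
abbrev Cyc {m : ℕ} (n : Fin m → ℕ) : Type := Σ s : Fin m, Fin (n s)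

section Matrices

variable {m : ℕ} [NeZero m] {n d : Fin m → ℕ} {R : Type*} [CommRing R]

/-- `X_s`, with entries given by `c`, as an endomorphism of `V_cyc` (zero outside of the block of
rows `s` and columns `s + 1`). -/
def matX (c : Coord n d → R) (s : Fin m) : Matrix (Cyc n) (Cyc n) R :=
  ∑ i, ∑ j, Matrix.single ⟨s, i⟩ ⟨s + 1, j⟩ (c (.x s i j))

/-- `Y_s` as an endomorphism of `V_cyc` (zero outside of the block of rows `s + 1` and
columns `s`). -/
def matY (c : Coord n d → R) (s : Fin m) : Matrix (Cyc n) (Cyc n) R :=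
  ∑ i, ∑ j, Matrix.single ⟨s + 1, i⟩ ⟨s, j⟩ (c (.y s i j))

/-- `V_{s,α}` as a row indexed by the basis of `V_cyc` (zero outside of the block `s`). -/
def rowV (c : Coord n d → R) (s : Fin m) (α : Fin (d s)) : Cyc n → R :=
  ∑ j, Pi.single ⟨s, j⟩ (c (.v s α j))

/-- `W_{s,α}` as a column indexed by the basis of `V_cyc` (zero outside of the block `s`). -/
def colW (c : Coord n d → R) (s : Fin m) (α : Fin (d s)) : Cyc n → R :=
  ∑ i, Pi.single ⟨s, i⟩ (c (.w s α i))

/-- The diagonal block, of size `n_s × n_s`, of an endomorphism of `V_cyc`. -/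
def block (s : Fin m) (M : Matrix (Cyc n) (Cyc n) R) : Matrix (Fin (n s)) (Fin (n s)) R :=
  M.submatrix (fun i => ⟨s, i⟩) (fun j => ⟨s, j⟩)

/-- `Id + X_s Y_s`, of size `n_s × n_s`. -/
def oneXY (c : Coord n d → R) (s : Fin m) : Matrix (Fin (n s)) (Fin (n s)) R :=
  1 + block s (matX c s * matY c s)

/-- `Id + Y_{s-1} X_{s-1}`, of size `n_s × n_s`. -/
def oneYX (c : Coord n d → R) (s : Fin m) : Matrix (Fin (n s)) (Fin (n s)) R :=
  1 + block s (matY c (s - 1) * matX c (s - 1))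

/-- The diagonal block `s` of `1 + W_p V_p`. For `p = (s, α)` this is `Id + W_{s,α} V_{s,α}`, of
size `n_s × n_s`. -/
def oneWV (c : Coord n d → R) (s : Fin m) (p : Σ s, Fin (d s)) :
    Matrix (Fin (n s)) (Fin (n s)) R :=
  1 + block s (Matrix.vecMulVec (colW c p.1 p.2) (rowV c p.1 p.2))

end Matrices

section Table

variable {m : ℕ} [NeZero m] {n d : Fin m → ℕ} {R : Type*} [CommRing R]

/-- Kronecker delta of a proposition. -/
def δ (P : Prop) [Decidable P] : R := if P then 1 else 0

/-- The ordering function: `+1` if `a < b`, `-1` if `a > b`, `0` if `a = b`. -/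
def ordSign (a b : ℕ) : R := if a < b then 1 else if b < a then -1 else 0

variable [Algebra ℂ R]

/-- `{V_{s,α} entry j, W_{r,β} entry k}`. -/
noncomputable def tableVW (c : Coord n d → R) (s : Fin m) (α : Fin (d s)) (j : Fin (n s))
    (r : Fin m) (β : Fin (d r)) (k : Fin (n r)) : R :=
  (1 / 2 : ℂ) • (ordSign s r * (colW c r β ⟨r, k⟩ * rowV c s α ⟨s, j⟩))
  + δ (s = r) * δ ((α : ℕ) = β) *
      (δ ((⟨r, k⟩ : Cyc n) = ⟨s, j⟩)
        + (1 / 2 : ℂ) • (colW c r β ⟨r, k⟩ * rowV c s α ⟨s, j⟩)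
        + (1 / 2 : ℂ) • (δ ((⟨r, k⟩ : Cyc n) = ⟨s, j⟩) * (rowV c s α ⬝ᵥ colW c r β)))
  + (1 / 2 : ℂ) • (δ (s = r) * ordSign α β *
      (δ ((⟨r, k⟩ : Cyc n) = ⟨s, j⟩) * (rowV c s α ⬝ᵥ colW c r β)
        + colW c r β ⟨r, k⟩ * rowV c s α ⟨s, j⟩))

/-- `{(X_r)_{ij}, (Y_s)_{kl}}`. -/
noncomputable def tableXY (c : Coord n d → R) (r : Fin m) (i : Fin (n r)) (j : Fin (n (r + 1)))
    (s : Fin m) (k : Fin (n (s + 1))) (l : Fin (n s)) : R :=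
  δ (s = r) *
      (δ ((⟨s + 1, k⟩ : Cyc n) = ⟨r + 1, j⟩) * δ ((⟨r, i⟩ : Cyc n) = ⟨s, l⟩)
        + (1 / 2 : ℂ) • ((matY c r * matX c r) ⟨s + 1, k⟩ ⟨r + 1, j⟩
            * δ ((⟨r, i⟩ : Cyc n) = ⟨s, l⟩))
        + (1 / 2 : ℂ) • (δ ((⟨s + 1, k⟩ : Cyc n) = ⟨r + 1, j⟩)
            * (matX c r * matY c r) ⟨r, i⟩ ⟨s, l⟩))
  - (1 / 2 : ℂ) • (δ (s = r - 1) * (matX c r ⟨s + 1, k⟩ ⟨r + 1, j⟩ * matY c (r - 1) ⟨r, i⟩ ⟨s, l⟩))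
  + (1 / 2 : ℂ) • (δ (s = r + 1) * (matY c (r + 1) ⟨s + 1, k⟩ ⟨r + 1, j⟩ * matX c r ⟨r, i⟩ ⟨s, l⟩))

/-- `{(X_r)_{ij}, (W_{s,α})_k}`. -/
noncomputable def tableXW (c : Coord n d → R) (r : Fin m) (i : Fin (n r)) (j : Fin (n (r + 1)))
    (s : Fin m) (α : Fin (d s)) (k : Fin (n s)) : R :=
  (1 / 2 : ℂ) • (δ (s = r + 1) * (δ ((⟨s, k⟩ : Cyc n) = ⟨r + 1, j⟩)
      * (matX c r *ᵥ colW c s α) ⟨r, i⟩))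
  - (1 / 2 : ℂ) • (δ (r = s) * (matX c r ⟨s, k⟩ ⟨r + 1, j⟩ * colW c s α ⟨r, i⟩))

/-- `{(X_r)_{ij}, (V_{s,α})_l}`. -/
noncomputable def tableXV (c : Coord n d → R) (r : Fin m) (i : Fin (n r)) (j : Fin (n (r + 1)))
    (s : Fin m) (α : Fin (d s)) (l : Fin (n s)) : R :=
  (1 / 2 : ℂ) • (δ (r = s) * ((rowV c s α ᵥ* matX c r) ⟨r + 1, j⟩
      * δ ((⟨r, i⟩ : Cyc n) = ⟨s, l⟩)))
  - (1 / 2 : ℂ) • (δ (s = r + 1) * (rowV c s α ⟨r + 1, j⟩ * matX c r ⟨r, i⟩ ⟨s, l⟩))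

/-- `{(Y_r)_{ij}, (W_{s,α})_k}`. -/
noncomputable def tableYW (c : Coord n d → R) (r : Fin m) (i : Fin (n (r + 1))) (j : Fin (n r))
    (s : Fin m) (α : Fin (d s)) (k : Fin (n s)) : R :=
  (1 / 2 : ℂ) • (δ (r = s) * (δ ((⟨s, k⟩ : Cyc n) = ⟨r, j⟩)
      * (matY c r *ᵥ colW c s α) ⟨r + 1, i⟩))
  - (1 / 2 : ℂ) • (δ (s = r + 1) * (matY c r ⟨s, k⟩ ⟨r, j⟩ * colW c s α ⟨r + 1, i⟩))

/-- `{(Y_r)_{ij}, (V_{s,α})_l}`. -/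
noncomputable def tableYV (c : Coord n d → R) (r : Fin m) (i : Fin (n (r + 1))) (j : Fin (n r))
    (s : Fin m) (α : Fin (d s)) (l : Fin (n s)) : R :=
  (1 / 2 : ℂ) • (δ (s = r + 1) * ((rowV c s α ᵥ* matY c r) ⟨r, j⟩
      * δ ((⟨r + 1, i⟩ : Cyc n) = ⟨s, l⟩)))
  - (1 / 2 : ℂ) • (δ (r = s) * (rowV c s α ⟨r, j⟩ * matY c r ⟨r + 1, i⟩ ⟨s, l⟩))

/-- The quasi-Poisson brackets of all pairs of coordinates. The pairs that are listed in the other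
order are obtained by antisymmetry. -/
noncomputable def table (c : Coord n d → R) : Coord n d → Coord n d → R
  | .x r i j, .x s k l =>
      (1 / 2 : ℂ) • (δ (s = r - 1) * ((matX c (r - 1) * matX c r) ⟨s, k⟩ ⟨r + 1, j⟩
        * δ ((⟨r, i⟩ : Cyc n) = ⟨s + 1, l⟩)))
      - (1 / 2 : ℂ) • (δ (s = r + 1) * (δ ((⟨s, k⟩ : Cyc n) = ⟨r + 1, j⟩)
        * (matX c r * matX c (r + 1)) ⟨r, i⟩ ⟨s + 1, l⟩))
  | .y r i j, .y s k l =>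
      (1 / 2 : ℂ) • (δ (s = r - 1) * (δ ((⟨s + 1, k⟩ : Cyc n) = ⟨r, j⟩)
        * (matY c r * matY c (r - 1)) ⟨r + 1, i⟩ ⟨s, l⟩))
      - (1 / 2 : ℂ) • (δ (s = r + 1) * ((matY c (r + 1) * matY c r) ⟨s + 1, k⟩ ⟨r, j⟩
        * δ ((⟨r + 1, i⟩ : Cyc n) = ⟨s, l⟩)))
  | .v s α j, .v r β l =>
      -((1 / 2 : ℂ) • (ordSign s r * (rowV c s α ⟨s, j⟩ * rowV c r β ⟨r, l⟩)))
      - (1 / 2 : ℂ) • (δ (s = r) * ordSign α β *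
          (rowV c r β ⟨s, j⟩ * rowV c s α ⟨r, l⟩ + rowV c s α ⟨s, j⟩ * rowV c r β ⟨r, l⟩))
  | .w s α i, .w r β k =>
      -((1 / 2 : ℂ) • (ordSign s r * (colW c r β ⟨r, k⟩ * colW c s α ⟨s, i⟩)))
      - (1 / 2 : ℂ) • (δ (s = r) * ordSign α β *
          (colW c r β ⟨r, k⟩ * colW c s α ⟨s, i⟩ + colW c s α ⟨r, k⟩ * colW c r β ⟨s, i⟩))
  | .x r i j, .y s k l => tableXY c r i j s k l
  | .y s k l, .x r i j => -tableXY c r i j s k l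
  | .x r i j, .w s α k => tableXW c r i j s α k
  | .w s α k, .x r i j => -tableXW c r i j s α k
  | .x r i j, .v s α l => tableXV c r i j s α l
  | .v s α l, .x r i j => -tableXV c r i j s α l
  | .y r i j, .w s α k => tableYW c r i j s α k
  | .w s α k, .y r i j => -tableYW c r i j s α k
  | .y r i j, .v s α l => tableYV c r i j s α l
  | .v s α l, .y r i j => -tableYV c r i j s α l
  | .v s α j, .w r β k => tableVW c s α j r β k
  | .w r β k, .v s α j => -tableVW c s α j r β k

end Table

section CoordinateRing

variable {m : ℕ} [NeZero m] (n d : Fin m → ℕ)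

/-- The polynomial functions whose non-vanishing defines `M^•` inside the affine space of
representations. -/
def nonvanishing : Set (MvPolynomial (Coord n d) ℂ) :=
  {f | (∃ s, f = (oneXY MvPolynomial.X s).det) ∨ (∃ s, f = (oneYX MvPolynomial.X s).det)
    ∨ (∃ s α, f = (oneWV MvPolynomial.X s ⟨s, α⟩).det)
    ∨ (∃ s α, f = 1 + rowV MvPolynomial.X s α ⬝ᵥ colW MvPolynomial.X s α)}

/-- The coordinate ring `ℂ[M^•]` of the open affine subvariety `M^•`. -/
abbrev CoordRing : Type := Localization (Submonoid.closure (nonvanishing n d))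

variable {n d}

/-- A coordinate, seen as a regular function on `M^•`. -/
noncomputable def coord (g : Coord n d) : CoordRing n d :=
  algebraMap (MvPolynomial (Coord n d) ℂ) (CoordRing n d) (MvPolynomial.X g)

instance : Algebra.FormallyEtale (MvPolynomial (Coord n d) ℂ) (CoordRing n d) :=
  Algebra.FormallyEtale.of_isLocalization (Submonoid.closure (nonvanishing n d))

/-- The partial derivative `∂/∂g` on `ℂ[M^•]`: the unique extension to the localization of the
partial derivative of polynomials. -/
noncomputable def partialD (g : Coord n d) : Derivation ℂ (CoordRing n d) (CoordRing n d) :=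
  ((MvPolynomial.mkDerivation ℂ (Pi.single g (1 : CoordRing n d))).liftKaehlerDifferential.liftBaseChange
      (CoordRing n d) ∘ₗ
    (KaehlerDifferential.tensorKaehlerEquivOfFormallyEtale ℂ (MvPolynomial (Coord n d) ℂ)
      (CoordRing n d)).symm.toLinearMap).compDer (KaehlerDifferential.D ℂ (CoordRing n d))

/-- The quasi-Poisson bracket on `ℂ[M^•]`, `{f, g} = bracket f g`: the biderivation
`{f, g} = ∑ {a, b} (∂f/∂a) (∂g/∂b)` over all pairs of coordinates `a`, `b`. -/
noncomputable def bracket :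
    Derivation ℂ (CoordRing n d) (Derivation ℂ (CoordRing n d) (CoordRing n d)) :=
  ∑ a : Coord n d, ∑ b : Coord n d,
    (LinearMap.toSpanSingleton (CoordRing n d) (Derivation ℂ (CoordRing n d) (CoordRing n d))
      (table coord a b • partialD b)).compDer (partialD a)

theorem partialD_algebraMap (g : Coord n d) (f : MvPolynomial (Coord n d) ℂ) :
    partialD g (algebraMap _ (CoordRing n d) f) =
      MvPolynomial.mkDerivation ℂ (Pi.single g (1 : CoordRing n d)) f := by
  simp [partialD, KaehlerDifferential.tensorKaehlerEquivOfFormallyEtale_symm_D_algebraMap]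

theorem partialD_coord (g h : Coord n d) : partialD g (coord h) = if h = g then 1 else 0 := by
  simp [coord, partialD_algebraMap, Pi.single_apply]

theorem sum_derivation_apply {ι A M : Type*} [CommRing A] [Algebra ℂ A] [AddCommGroup M]
    [Module A M] [Module ℂ M] (t : Finset ι) (D : ι → Derivation ℂ A M) (f : A) :
    (∑ i ∈ t, D i) f = ∑ i ∈ t, D i f := by
  classical
  induction t using Finset.induction_on with
  | empty => simp
  | insert i t hi ih => simp [Finset.sum_insert hi, ih]

theorem bracket_apply (f g : CoordRing n d) :
    bracket f g = ∑ a, ∑ b, table coord a b * partialD a f * partialD b g := by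
  simp only [bracket, sum_derivation_apply]
  refine Finset.sum_congr rfl fun a _ => Finset.sum_congr rfl fun b _ => ?_
  change partialD a f * (table coord a b * partialD b g) = _
  ring

theorem bracket_coord (a b : Coord n d) : bracket (coord a) (coord b) = table coord a b := by
  simp [bracket_apply, partialD_coord]

theorem table_antisymm {R : Type*} [CommRing R] [Algebra ℂ R] (c : Coord n d → R)
    (a b : Coord n d) : table c a b = -table c b a := by
  have hδ : ∀ (P Q : Prop) [Decidable P] [Decidable Q], (P ↔ Q) → (δ P : R) = δ Q := by
    intro P Q _ _ h
    simp [δ, h]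
  have ho : ∀ a b : ℕ, (ordSign a b : R) = -ordSign b a := by
    intro a b
    unfold ordSign
    split_ifs <;> first | omega | simp
  have hδ' : ∀ s r : Fin m, (δ (s = r - 1) : R) = δ (r = s + 1) := fun s r =>
    hδ _ _ ⟨fun h => by rw [h, sub_add_cancel], fun h => by rw [h, add_sub_cancel_right]⟩
  have hx : ∀ (F : Fin m → Fin m → R) (s r : Fin m),
      δ (r = s + 1) * F (r - 1) r = δ (r = s + 1) * F s (s + 1) := by
    intro F s r
    by_cases h : r = s + 1
    · subst h
      rw [add_sub_cancel_right]
    · simp [δ, h]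
  cases a <;> cases b <;> simp only [table, neg_neg]
  case x.x r i j s k l =>
    rw [hδ' s r, hδ' r s,
      hx (fun a b => (matX c a * matX c b) ⟨s, k⟩ ⟨r + 1, j⟩ * δ ((⟨r, i⟩ : Cyc n) = ⟨s + 1, l⟩)),
      hx (fun a b => (matX c a * matX c b) ⟨r, i⟩ ⟨s + 1, l⟩ * δ ((⟨s, k⟩ : Cyc n) = ⟨r + 1, j⟩))]
    simp only [mul_comm]
    abel
  case y.y r i j s k l =>
    rw [hδ' s r, hδ' r s,
      hx (fun a b => δ ((⟨s + 1, k⟩ : Cyc n) = ⟨r, j⟩) * (matY c b * matY c a) ⟨r + 1, i⟩ ⟨s, l⟩),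
      hx (fun a b => δ ((⟨r + 1, i⟩ : Cyc n) = ⟨s, l⟩) * (matY c b * matY c a) ⟨s + 1, k⟩ ⟨r, j⟩)]
    simp only [mul_comm]
    abel
  case v.v r i j s k l =>
    rw [ho r s, ho i k, hδ (r = s) (s = r) eq_comm]
    simp only [← smul_neg, ← smul_sub]
    congr 1
    ring
  case w.w r i j s k l =>
    rw [ho r s, ho i k, hδ (r = s) (s = r) eq_comm]
    simp only [← smul_neg, ← smul_sub]
    congr 1
    ring

theorem bracket_antisymm (f g : CoordRing n d) : bracket f g = -bracket g f := by
  rw [bracket_apply, bracket_apply, Finset.sum_comm, ← Finset.sum_neg_distrib]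
  refine Finset.sum_congr rfl fun a _ => ?_
  rw [← Finset.sum_neg_distrib]
  refine Finset.sum_congr rfl fun b _ => ?_
  rw [table_antisymm coord b a]
  ring

end CoordinateRing

section Algebras

variable {m : ℕ} [NeZero m] (n d : Fin m → ℕ)

/-- Spin indices `(s, α)`, with the lexicographic order. -/
abbrev Spin {m : ℕ} (d : Fin m → ℕ) : Type := Σₗ s : Fin m, Fin (d s)

theorem card_spin {m : ℕ} (d : Fin m → ℕ) : Fintype.card (Spin d) = ∑ s, d s := by
  rw [Fintype.card_congr ofLex]
  simp

/-- The increasing enumeration of the spin indices; `ρ d ⟨c, _⟩` is the `(c + 1)`-st one. -/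
def ρ {m : ℕ} (d : Fin m → ℕ) : Fin (∑ s, d s) ≃o Spin d :=
  Fintype.orderIsoFinOfCardEq (Spin d) (card_spin d)

/-- The component `Φ_s^{(b)}` of the moment map attached to the subquiver that contains the first
`b` spin indices, as a matrix of regular functions on `M^•`. -/
noncomputable def Φ : ℕ → (s : Fin m) → Matrix (Fin (n s)) (Fin (n s)) (CoordRing n d)
  | 0, s => oneXY coord s * (oneYX coord s)⁻¹
  | c + 1, s =>
      if h : c < ∑ s, d s then
        if (ofLex (ρ d ⟨c, h⟩)).1 = s then Φ c s * (oneWV coord s (ofLex (ρ d ⟨c, h⟩)))⁻¹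
        else Φ c s
      else Φ c s

/-- `X = ∑ X_s` as an endomorphism of `V_cyc`. -/
noncomputable def matXcyc : Matrix (Cyc n) (Cyc n) (CoordRing n d) := ∑ s, matX coord s

/-- `Y = ∑ Y_s` as an endomorphism of `V_cyc`. -/
noncomputable def matYcyc : Matrix (Cyc n) (Cyc n) (CoordRing n d) := ∑ s, matY coord s

/-- `Φ^{(b)} = ∑ Φ_s^{(b)}` as a block diagonal endomorphism of `V_cyc`. -/
noncomputable def Φcyc (b : ℕ) : Matrix (Cyc n) (Cyc n) (CoordRing n d) :=
  Matrix.blockDiagonal' (Φ n d b)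

/-- The algebra `L_+`. -/
noncomputable def Lplus : Subalgebra ℂ (CoordRing n d) :=
  Algebra.adjoin ℂ {f | ∃ (k : ℕ) (s : Fin m) (b : ℕ), b ≤ ∑ s, d s ∧
    f = ((Φ n d b s * (oneXY coord s)⁻¹) ^ k).trace}

/-- The algebra `L_+^cyc`. -/
noncomputable def LplusCyc : Subalgebra ℂ (CoordRing n d) :=
  Algebra.adjoin ℂ {f | ∃ (k : ℕ) (b : ℕ), b ≤ ∑ s, d s ∧
    f = ((Φcyc n d b * (1 + matXcyc n d * matYcyc n d)⁻¹) ^ k).trace}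

variable {n d}

/-- A subalgebra `L` of `ℂ[M^•]` is a Poisson algebra (for the restriction of the quasi-Poisson
bracket, which is a biderivation): it is closed under the bracket, and on `L` the bracket is
antisymmetric and satisfies the Jacobi identity. -/
structure IsPoissonSubalgebra (L : Subalgebra ℂ (CoordRing n d)) : Prop where
  bracket_mem : ∀ f ∈ L, ∀ g ∈ L, bracket f g ∈ L
  antisymm : ∀ f ∈ L, ∀ g ∈ L, bracket f g = -bracket g f
  jacobi : ∀ f ∈ L, ∀ g ∈ L, ∀ h ∈ L,
    bracket f (bracket g h) + bracket g (bracket h f) + bracket h (bracket f g) = 0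

/-- An abelian Poisson algebra: a Poisson algebra whose bracket is identically zero. -/
structure IsAbelianPoissonSubalgebra (L : Subalgebra ℂ (CoordRing n d)) : Prop
    extends IsPoissonSubalgebra L where
  abelian : ∀ f ∈ L, ∀ g ∈ L, bracket f g = 0

end Algebras

end CyclicQuiver

/-! Write `U_{b,s}` for `momentProduct`, the product of `1 + Y_{s-1} X_{s-1}` and of the factors `1
+ W_p V_p` at `s` among the first `b` spin indices, later factors on the left. Then `Φ_s^{(b)} = T_s
U_{b,s}⁻¹`, so `Φ_s^{(b)} T_s⁻¹` is conjugate to `U_{b,s}⁻¹` and the generators of `Lplus` are the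
functions `tr (U_{b,s}⁻ᵏ)` (`trace_Φ_pow`). Neither `T_s` nor the bracket of an inverse matrix has
to be computed.

The factors behave like group-valued moment maps that are fused in the order of `ρ`. Each one has
the moment map bracket with itself, and two factors at one vertex have the fusion bracket
`IsFusionPair`. By the Leibniz rule these relations pass to products: for `b ≤ c` the matrices `P =
U_{b,s}` and `U = U_{c,s}` satisfy `IsNestedPair` (`isNestedPair_momentProduct`). The differential
of `tr (P⁻ᵏ)` is a contraction of `dP` with a matrix `G` that commutes with `P`. Contracting the
nested bracket with such a `G` gives terms that cancel by cyclicity of the trace, whatever the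
contraction on the side of `U`. So `tr (P⁻ᵏ)` Poisson commutes with every entry of `U`.

At different vertices the entries of the two products already commute
(`matBracket_momentProduct_of_ne`). Hence all generators commute, and the biderivation vanishes on
the algebra that they generate. Since `Φ^{(b)} (1 + XY)⁻¹` is block diagonal, the cyclic algebra
lies inside `Lplus`, and nothing more is needed for it. -/

namespace CyclicQuiver

set_option linter.unusedSectionVars false

/-! ### Calculus of brackets between matrix entries, encoded by contraction with an arbitrary
matrix. -/

section MatrixBracket

variable {R : Type*} [CommRing R] [Algebra ℂ R] {a b b' c d d' : Type*}
  [Fintype a] [Fintype b] [Fintype b'] [Fintype c] [Fintype d] [Fintype d']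

/-- The contraction `∑ Z_{lk} {A_{ij}, B_{kl}}` of the brackets of the entries of two matrices. -/
def matBracket (D : Derivation ℂ R (Derivation ℂ R R)) (A : Matrix a b R) (B : Matrix c d R)
    (Z : Matrix d c R) : Matrix a b R :=
  Matrix.of fun i j => ∑ k, ∑ l, Z l k * D (A i j) (B k l)

variable (D : Derivation ℂ R (Derivation ℂ R R))

theorem sum_derivation_apply₂ {ι : Type*} (t : Finset ι) (f : ι → R) (g : R) :
    D (∑ i ∈ t, f i) g = ∑ i ∈ t, D (f i) g := by
  rw [map_sum, sum_derivation_apply]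

theorem matBracket_add_left (A A' : Matrix a b R) (B : Matrix c d R) (Z : Matrix d c R) :
    matBracket D (A + A') B Z = matBracket D A B Z + matBracket D A' B Z := by
  ext i j
  simp [matBracket, mul_add, Finset.sum_add_distrib]

theorem matBracket_add_right (A : Matrix a b R) (B B' : Matrix c d R) (Z : Matrix d c R) :
    matBracket D A (B + B') Z = matBracket D A B Z + matBracket D A B' Z := by
  ext i j
  simp [matBracket, mul_add, Finset.sum_add_distrib]

/-- The Leibniz rule. In the first slot the spectator factor multiplies the result from outside; in
the second slot (`matBracket_mul_right`) it is absorbed into `Z`. Brackets of products therefore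
become manipulations of words in matrices. -/
theorem matBracket_mul_left (A : Matrix a b R) (A' : Matrix b b' R) (B : Matrix c d R)
    (Z : Matrix d c R) :
    matBracket D (A * A') B Z = A * matBracket D A' B Z + matBracket D A B Z * A' := by
  ext i j
  simp only [matBracket, Matrix.mul_apply, Matrix.of_apply, Matrix.add_apply, sum_derivation_apply₂,
    Derivation.leibniz, Derivation.add_apply, Derivation.smul_apply, smul_eq_mul, Finset.mul_sum,
    Finset.sum_mul, mul_add, Finset.sum_add_distrib]
  congr 1
  · conv_rhs => rw [Finset.sum_comm]
    refine Finset.sum_congr rfl fun k _ => ?_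
    rw [Finset.sum_comm]
    refine Finset.sum_congr rfl fun p _ => Finset.sum_congr rfl fun l _ => ?_
    ring
  · conv_rhs => rw [Finset.sum_comm]
    refine Finset.sum_congr rfl fun k _ => ?_
    rw [Finset.sum_comm]
    refine Finset.sum_congr rfl fun p _ => Finset.sum_congr rfl fun l _ => ?_
    ring

theorem matBracket_mul_right (A : Matrix a b R) (B : Matrix c d R) (C : Matrix d d' R)
    (Z : Matrix d' c R) :
    matBracket D A (B * C) Z = matBracket D A B (C * Z) + matBracket D A C (Z * B) := by
  ext i j
  simp only [matBracket, Matrix.mul_apply, Matrix.of_apply, Matrix.add_apply, map_sum,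
    Derivation.leibniz, smul_eq_mul, Finset.mul_sum, Finset.sum_mul, mul_add,
    Finset.sum_add_distrib]
  rw [add_comm]
  congr 1
  · refine Finset.sum_congr rfl fun k _ => ?_
    rw [Finset.sum_comm]
    refine Finset.sum_congr rfl fun p _ => Finset.sum_congr rfl fun l _ => ?_
    ring
  · refine (Finset.sum_congr rfl fun k _ => Finset.sum_comm).trans ?_
    rw [Finset.sum_comm]
    refine Finset.sum_congr rfl fun p _ => ?_
    rw [Finset.sum_comm]
    refine Finset.sum_congr rfl fun l _ => Finset.sum_congr rfl fun k _ => ?_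
    ring

/-- The dictionary between the entrywise table and matrices: a term `α_{kj} β_{il}` in a bracket
contributes the word `β Z α`. -/
theorem sum_sum_mul_mul (Z : Matrix d c R) (α : Matrix c b R) (β : Matrix a d R) (i : a) (j : b) :
    ∑ k, ∑ l, Z l k * (α k j * β i l) = (β * Z * α) i j := by
  simp only [Matrix.mul_apply, Finset.sum_mul]
  refine Finset.sum_congr rfl fun k _ => Finset.sum_congr rfl fun l _ => ?_
  ring

theorem trace_mul_matBracket (A : Matrix a b R) (B : Matrix c d R) (Y : Matrix b a R)
    (Z : Matrix d c R) :
    (Y * matBracket D A B Z).trace =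
      ∑ i, ∑ j, ∑ k, ∑ l, Y j i * Z l k * D (A i j) (B k l) := by
  simp only [matBracket, Matrix.trace, Matrix.diag_apply, Matrix.mul_apply, Matrix.of_apply,
    Finset.mul_sum]
  rw [Finset.sum_comm]
  simp only [mul_assoc]

theorem sum_sum_comm (f : a → b → c → d → R) :
    ∑ i, ∑ j, ∑ k, ∑ l, f i j k l = ∑ k, ∑ l, ∑ i, ∑ j, f i j k l := by
  simp only [← Fintype.sum_prod_type' (f := fun i j => ∑ k, ∑ l, f i j k l)]
  rw [Finset.sum_comm]
  refine Finset.sum_congr rfl fun k _ => ?_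
  rw [Finset.sum_comm]
  simp only [Fintype.sum_prod_type]

/-- Antisymmetry of the bracket, in terms of contractions. -/
theorem matBracket_swap (hD : ∀ f g, D f g = -D g f) {A : Matrix a b R} {B : Matrix c d R}
    {G : Matrix b a R → Matrix c d R}
    (h : ∀ Y Z, (Y * matBracket D A B Z).trace = -(Z * G Y).trace) (Y : Matrix b a R) :
    matBracket D B A Y = G Y := by
  -- The trace pairing is nondegenerate, so it suffices to compare full contractions, which are
  -- symmetric in the two matrices up to the sign of the bracket.
  rw [Matrix.ext_iff_trace_mul_left]
  intro Z
  rw [← neg_eq_iff_eq_neg.mpr (h Y Z), trace_mul_matBracket, trace_mul_matBracket]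
  simp only [← Finset.sum_neg_distrib]
  rw [sum_sum_comm]
  refine Finset.sum_congr rfl fun i _ => Finset.sum_congr rfl fun j _ =>
    Finset.sum_congr rfl fun k _ => Finset.sum_congr rfl fun l _ => ?_
  rw [hD]
  ring

theorem trace_mul_sandwich (Y : Matrix b a R) (A : Matrix a d R) (Z : Matrix d c R)
    (B : Matrix c b R) : (Y * (A * Z * B)).trace = (Z * (B * Y * A)).trace := by
  rw [Matrix.mul_assoc A, ← Matrix.mul_assoc Y, Matrix.trace_mul_comm, Matrix.mul_assoc Z,
    Matrix.mul_assoc B]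

end MatrixBracket

/-! ### Fusion and nested pairs: how moment map brackets propagate to products. -/

section Fusion

variable {R : Type*} [CommRing R] [Algebra ℂ R] {ι : Type*} [Fintype ι] [DecidableEq ι]
  (D : Derivation ℂ R (Derivation ℂ R R)) (e : Matrix ι ι R)

/-- `M` belongs to the corner ring of the idempotent `e`. -/
structure InCorner (M : Matrix ι ι R) : Prop where
  left : e * M = M
  right : M * e = M

/-- The brackets of the entries of `P` with those of `Q` are those of group-valued moment maps
whose product, in the order of fusion, is `Q * P`. -/
def IsFusionPair (P Q : Matrix ι ι R) : Prop :=
  ∀ Z, matBracket D P Q Z =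
    (1 / 2 : ℂ) • (P * Q * Z * e + e * Z * Q * P - Q * Z * P - P * Z * Q)

/-- The brackets of the entries of `P` with those of `U`, when `U` is obtained from `P` by
multiplication by further moment maps on the left. -/
def IsNestedPair (P U : Matrix ι ι R) : Prop :=
  ∀ Z, matBracket D P U Z =
    (1 / 2 : ℂ) • (P * U * Z * e + P * Z * U - U * Z * P - e * Z * U * P)

variable {D e} {P P' Q U : Matrix ι ι R}

theorem InCorner.left_assoc (h : InCorner e P) (M : Matrix ι ι R) : e * (P * M) = P * M := by
  rw [← Matrix.mul_assoc, h.left]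

theorem InCorner.right_assoc (h : InCorner e P) (M : Matrix ι ι R) : P * (e * M) = P * M := by
  rw [← Matrix.mul_assoc, h.right]

/-- The Leibniz rule produces eight terms. Those with `Q` between `P` and `P'`, namely `P * Q * Z *
P'` and `P * Z * Q * P'`, occur with both signs and cancel; the other four are the fusion bracket of
the product. -/
theorem IsFusionPair.mul_left (h : IsFusionPair D e P Q) (h' : IsFusionPair D e P' Q)
    (hP : InCorner e P) (hP' : InCorner e P') : IsFusionPair D e (P * P') Q := by
  intro Z
  rw [matBracket_mul_left, h, h']
  simp only [Matrix.mul_assoc, Matrix.mul_add, Matrix.add_mul, Matrix.mul_sub, Matrix.sub_mul,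
    Matrix.mul_smul, Matrix.smul_mul, hP.right_assoc, hP'.left]
  module

/-- The terms `P * U * Z * Q` and `U * Z * Q * P` cancel between the two brackets, which lets a
nested chain grow by one later factor. -/
theorem IsNestedPair.mul_right (h : IsNestedPair D e P U) (h' : IsFusionPair D e P Q)
    (hU : InCorner e U) (hQ : InCorner e Q) : IsNestedPair D e P (Q * U) := by
  intro Z
  rw [matBracket_mul_right, h, h']
  simp only [Matrix.mul_assoc, hU.left_assoc, hQ.right]
  module

theorem IsFusionPair.swap (hD : ∀ f g, D f g = -D g f) (h : IsFusionPair D e P Q)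
    (Z : Matrix ι ι R) : matBracket D Q P Z =
      -((1 / 2 : ℂ) • (e * Z * P * Q + Q * P * Z * e - P * Z * Q - Q * Z * P)) := by
  refine matBracket_swap D hD (G := fun Z =>
    -((1 / 2 : ℂ) • (e * Z * P * Q + Q * P * Z * e - P * Z * Q - Q * Z * P))) (fun Y Z => ?_) Z
  rw [h]
  simp only [Matrix.mul_add, Matrix.mul_sub, Matrix.mul_smul, Matrix.mul_neg, Matrix.trace_add,
    Matrix.trace_sub, Matrix.trace_neg, Matrix.trace_smul, neg_neg]
  congr 1
  rw [trace_mul_sandwich Y (P * Q) Z e, trace_mul_sandwich Y Q Z P, trace_mul_sandwich Y P Z Q,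
    Matrix.mul_assoc (e * Z), trace_mul_sandwich Y e Z (Q * P), Matrix.mul_assoc (e * Y)]

/-- For `U = P` the middle terms of `IsNestedPair` cancel and what remains is the bracket of a
group-valued moment map with itself. The lemma says that fusing two moment maps gives a moment map.
-/
theorem IsNestedPair.self_mul (hD : ∀ f g, D f g = -D g f) (hP : InCorner e P)
    (hQ : InCorner e Q) (h : IsNestedPair D e P P) (h' : IsNestedPair D e Q Q)
    (hPQ : IsFusionPair D e P Q) : IsNestedPair D e (Q * P) (Q * P) := by
  intro Z
  rw [matBracket_mul_right, matBracket_mul_left, matBracket_mul_left, hPQ, hPQ.swap hD, h, h']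
  simp only [Matrix.mul_assoc, Matrix.mul_add, Matrix.add_mul, Matrix.mul_sub, Matrix.sub_mul,
    Matrix.neg_mul, Matrix.mul_smul, Matrix.smul_mul, hQ.right_assoc, hP.left_assoc, hP.left,
    hQ.right]
  module

/-- Contractions of the brackets of a nested pair with a matrix that commutes with the inner
member vanish. -/
theorem IsNestedPair.trace_eq_zero (h : IsNestedPair D e P U) {G : Matrix ι ι R}
    (hG : InCorner e G) (hGP : G * P = P * G) (Z : Matrix ι ι R) :
    (G * matBracket D P U Z).trace = 0 := by
  -- The four terms of the nested bracket pair off: cyclicity and `G * P = P * G` move `P` around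
  -- the trace, while `e` is absorbed into `G`.
  have h1 : (G * (P * U * Z * e)).trace = (G * (U * Z * P)).trace := by
    rw [Matrix.trace_mul_comm, Matrix.mul_assoc (P * U * Z), hG.left, Matrix.trace_mul_comm,
      ← Matrix.mul_assoc, ← Matrix.mul_assoc, hGP, Matrix.mul_assoc P, Matrix.mul_assoc P,
      Matrix.trace_mul_comm P]
    simp only [Matrix.mul_assoc]
  have h2 : (G * (e * Z * U * P)).trace = (G * (P * Z * U)).trace := by
    simp only [← Matrix.mul_assoc, hG.right]
    rw [Matrix.trace_mul_comm (G * Z * U) P, hGP]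
    simp only [← Matrix.mul_assoc]
  rw [h]
  simp only [Matrix.mul_add, Matrix.mul_sub, Matrix.mul_smul, Matrix.trace_add, Matrix.trace_sub,
    Matrix.trace_smul, h1, h2]
  simp

end Fusion

/-! ### The coordinate matrices and the projections onto the vertices. -/

section Blocks

variable {m : ℕ} [NeZero m] {n d : Fin m → ℕ} {R : Type*} [CommRing R] (c : Coord n d → R)

/-- The projection of `V_cyc` onto the summand at the vertex `s`. -/
def proj (n : Fin m → ℕ) (R : Type*) [CommRing R] (s : Fin m) : Matrix (Cyc n) (Cyc n) R :=
  Matrix.diagonal fun a => if a.1 = s then 1 else 0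

/-- `V_{s,α}` as a matrix with one row. -/
def matV (s : Fin m) (α : Fin (d s)) : Matrix Unit (Cyc n) R :=
  Matrix.replicateRow Unit (rowV c s α)

/-- `W_{s,α}` as a matrix with one column. -/
def matW (s : Fin m) (α : Fin (d s)) : Matrix (Cyc n) Unit R :=
  Matrix.replicateCol Unit (colW c s α)

theorem matV_apply (s : Fin m) (α : Fin (d s)) (u : Unit) (a : Cyc n) :
    matV c s α u a = rowV c s α a := rfl

theorem matW_apply (s : Fin m) (α : Fin (d s)) (u : Unit) (a : Cyc n) :
    matW c s α a u = colW c s α a := rfl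

theorem matX_mk (s : Fin m) (i : Fin (n s)) (j : Fin (n (s + 1))) :
    matX c s ⟨s, i⟩ ⟨s + 1, j⟩ = c (.x s i j) := by
  simp [matX, Matrix.sum_apply, Matrix.single_apply, ite_and]

theorem matX_of_ne_left {s : Fin m} {a : Cyc n} (h : a.1 ≠ s) (b : Cyc n) :
    matX c s a b = 0 := by
  have : ∀ i, (⟨s, i⟩ : Cyc n) ≠ a := by rintro i rfl; exact h rfl
  simp [matX, Matrix.sum_apply, this]

theorem matX_of_ne_right {s : Fin m} {b : Cyc n} (h : b.1 ≠ s + 1) (a : Cyc n) :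
    matX c s a b = 0 := by
  have : ∀ i, (⟨s + 1, i⟩ : Cyc n) ≠ b := by rintro i rfl; exact h rfl
  simp [matX, Matrix.sum_apply, this]

theorem matY_mk (s : Fin m) (i : Fin (n (s + 1))) (j : Fin (n s)) :
    matY c s ⟨s + 1, i⟩ ⟨s, j⟩ = c (.y s i j) := by
  simp [matY, Matrix.sum_apply, Matrix.single_apply, ite_and]

theorem matY_of_ne_left {s : Fin m} {a : Cyc n} (h : a.1 ≠ s + 1) (b : Cyc n) :
    matY c s a b = 0 := by
  have : ∀ i, (⟨s + 1, i⟩ : Cyc n) ≠ a := by rintro i rfl; exact h rfl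
  simp [matY, Matrix.sum_apply, this]

theorem matY_of_ne_right {s : Fin m} {b : Cyc n} (h : b.1 ≠ s) (a : Cyc n) :
    matY c s a b = 0 := by
  have : ∀ i, (⟨s, i⟩ : Cyc n) ≠ b := by rintro i rfl; exact h rfl
  simp [matY, Matrix.sum_apply, this]

theorem rowV_mk (s : Fin m) (α : Fin (d s)) (j : Fin (n s)) :
    rowV c s α ⟨s, j⟩ = c (.v s α j) := by
  simp [rowV, Finset.sum_apply, Pi.single_apply]

theorem rowV_of_ne {s : Fin m} {a : Cyc n} (h : a.1 ≠ s) (α : Fin (d s)) :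
    rowV c s α a = 0 := by
  have : ∀ i, a ≠ (⟨s, i⟩ : Cyc n) := by rintro i rfl; exact h rfl
  simp [rowV, Finset.sum_apply, this]

theorem colW_mk (s : Fin m) (α : Fin (d s)) (j : Fin (n s)) :
    colW c s α ⟨s, j⟩ = c (.w s α j) := by
  simp [colW, Finset.sum_apply, Pi.single_apply]

theorem colW_of_ne {s : Fin m} {a : Cyc n} (h : a.1 ≠ s) (α : Fin (d s)) :
    colW c s α a = 0 := by
  have : ∀ i, a ≠ (⟨s, i⟩ : Cyc n) := by rintro i rfl; exact h rfl
  simp [colW, Finset.sum_apply, this]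

theorem proj_mul_matX (s : Fin m) : proj n R s * matX c s = matX c s := by
  ext a b
  by_cases h : a.1 = s
  · simp [proj, h]
  · simp [proj, h, matX_of_ne_left]

theorem matX_mul_proj (s : Fin m) : matX c s * proj n R (s + 1) = matX c s := by
  ext a b
  by_cases h : b.1 = s + 1
  · simp [proj, h]
  · simp [proj, h, matX_of_ne_right]

theorem proj_mul_matY (s : Fin m) : proj n R (s + 1) * matY c s = matY c s := by
  ext a b
  by_cases h : a.1 = s + 1
  · simp [proj, h]
  · simp [proj, h, matY_of_ne_left]

theorem matY_mul_proj (s : Fin m) : matY c s * proj n R s = matY c s := by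
  ext a b
  by_cases h : b.1 = s
  · simp [proj, h]
  · simp [proj, h, matY_of_ne_right]

theorem proj_mul_matW (s : Fin m) (α : Fin (d s)) : proj n R s * matW c s α = matW c s α := by
  ext a b
  rw [proj, Matrix.diagonal_mul]
  by_cases h : a.1 = s
  · simp [h]
  · simp [h, matW_apply, colW_of_ne]

theorem matV_mul_proj (s : Fin m) (α : Fin (d s)) : matV c s α * proj n R s = matV c s α := by
  ext a b
  rw [proj, Matrix.mul_diagonal]
  by_cases h : b.1 = s
  · simp [h]
  · simp [h, matV_apply, rowV_of_ne]

theorem matW_mul_matV_apply (r s : Fin m) (α : Fin (d s)) (β : Fin (d r)) (k j : Cyc n) :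
    (matW c r β * matV c s α) k j = colW c r β k * rowV c s α j := by
  simp [Matrix.mul_apply, matW_apply, matV_apply]

theorem mul_matW_apply {κ : Type*} (M : Matrix κ (Cyc n) R) (s : Fin m) (α : Fin (d s)) (k : κ)
    (u : Unit) : (M * matW c s α) k u = (M *ᵥ colW c s α) k := rfl

theorem matV_mul_apply {κ : Type*} (M : Matrix (Cyc n) κ R) (s : Fin m) (α : Fin (d s)) (k : κ)
    (u : Unit) : (matV c s α * M) u k = (rowV c s α ᵥ* M) k := rfl

theorem matV_mul_matW_apply (r s : Fin m) (α : Fin (d s)) (β : Fin (d r)) (u v : Unit) :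
    (matV c s α * matW c r β) u v = rowV c s α ⬝ᵥ colW c r β := rfl

theorem proj_mul_self (s : Fin m) : proj n R s * proj n R s = proj n R s := by
  simp only [proj, Matrix.diagonal_mul_diagonal]
  congr 1
  ext a
  split_ifs <;> simp

theorem proj_mul_proj_of_ne {s t : Fin m} (h : s ≠ t) :
    proj n R s * proj n R t = 0 := by
  simp only [proj, Matrix.diagonal_mul_diagonal]
  rw [← Matrix.diagonal_zero]
  congr 1
  ext a
  split_ifs with h1 h2
  · exact absurd (h1.symm.trans h2) h
  all_goals simp

end Blocks

/-! ### From entrywise brackets on blocks to matrix identities. -/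

section Entries

/-- Deltas of vertices, like order signs below, become complex scalars that `module` can handle,
whereas deltas of basis indices become entries of the identity matrix. -/
theorem δ_mul_eq_smul {R : Type*} [CommRing R] [Algebra ℂ R] (P : Prop) [Decidable P] (x : R) :
    δ P * x = (δ P : ℂ) • x := by
  by_cases h : P <;> simp [δ, h]

theorem ordSign_mul_eq_smul {R : Type*} [CommRing R] [Algebra ℂ R] (i j : ℕ) (x : R) :
    ordSign i j * x = (ordSign i j : ℂ) • x := by
  unfold ordSign
  split_ifs <;> simp

theorem δ_eq_one_apply {R : Type*} [CommRing R] {m : ℕ} {n : Fin m → ℕ} (i j : Cyc n) :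
    (δ (i = j) : R) = (1 : Matrix (Cyc n) (Cyc n) R) i j := by
  rw [Matrix.one_apply, δ]

/-- The diagonal matrix of the indicator function of `p`. -/
def indicatorMatrix (R : Type*) [CommRing R] {κ : Type*} [DecidableEq κ] (p : κ → Prop)
    [DecidablePred p] : Matrix κ κ R :=
  Matrix.diagonal fun k => if p k then 1 else 0

theorem indicatorMatrix_true {R κ : Type*} [CommRing R] [DecidableEq κ] :
    indicatorMatrix R (fun _ : κ => True) = 1 := by
  simp [indicatorMatrix]

theorem indicatorMatrix_eq_proj {R : Type*} [CommRing R] {m : ℕ} {n : Fin m → ℕ} (s : Fin m) :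
    indicatorMatrix R (fun a : Cyc n => a.1 = s) = proj n R s := rfl

/-- The entries of `A` vanish outside of the rows `p` and the columns `q`. -/
structure SupportedOn {R : Type*} [CommRing R] {a b : Type*} (p : a → Prop) (q : b → Prop)
    (A : Matrix a b R) : Prop where
  left : ∀ i j, ¬p i → A i j = 0
  right : ∀ i j, ¬q j → A i j = 0

/-- Computes `matBracket` from the brackets of the entries in the blocks that support the two
matrices. The members `(c, α, β)` of the list stand for the terms `c α_{kj} β_{il}`. -/
theorem matBracket_of_entries {R : Type*} [CommRing R] [Algebra ℂ R] {a b c d : Type*} [Fintype a]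
    [Fintype b] [Fintype c] [Fintype d] [DecidableEq a] [DecidableEq b] [DecidableEq c]
    [DecidableEq d] (D : Derivation ℂ R (Derivation ℂ R R)) {A : Matrix a b R} {B : Matrix c d R}
    {p : a → Prop} {q : b → Prop} {u : c → Prop} {v : d → Prop}
    [DecidablePred p] [DecidablePred q] [DecidablePred u] [DecidablePred v]
    (hA : SupportedOn p q A) (hB : SupportedOn u v B)
    (L : List (ℂ × Matrix c b R × Matrix a d R))
    (hD : ∀ i j k l, p i → q j → u k → v l →
      D (A i j) (B k l) = (L.map fun t => t.1 • (t.2.1 k j * t.2.2 i l)).sum) (Z : Matrix d c R) :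
    matBracket D A B Z = (L.map fun t => t.1 • (indicatorMatrix R p * (t.2.2 *
      (indicatorMatrix R v * (Z * (indicatorMatrix R u * (t.2.1 * indicatorMatrix R q))))))).sum := by
  have hL : ∀ (Z : Matrix d c R) i j,
      ∑ k, ∑ l, Z l k * (L.map fun t => t.1 • (t.2.1 k j * t.2.2 i l)).sum =
        (L.map fun t => t.1 • (t.2.2 * Z * t.2.1)).sum i j := by
    intro Z i j
    clear hD
    induction L with
    | nil => simp
    | cons t L ih =>
      simp only [List.map_cons, List.sum_cons, mul_add, Finset.sum_add_distrib, ih,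
        Matrix.add_apply, mul_smul_comm, ← Finset.smul_sum, sum_sum_mul_mul, Matrix.smul_apply]
  have hR : (L.map fun t => t.1 • (indicatorMatrix R p * (t.2.2 *
      (indicatorMatrix R v * (Z * (indicatorMatrix R u * (t.2.1 * indicatorMatrix R q))))))).sum =
      indicatorMatrix R p * (L.map fun t => t.1 • (t.2.2 *
        (indicatorMatrix R v * Z * indicatorMatrix R u) * t.2.1)).sum * indicatorMatrix R q := by
    clear hD hL
    induction L with
    | nil => simp
    | cons t L ih =>
      simp only [List.map_cons, List.sum_cons, ih, Matrix.mul_add, Matrix.add_mul, Matrix.mul_smul,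
        Matrix.smul_mul, Matrix.mul_assoc]
  rw [hR]
  ext i j
  simp only [indicatorMatrix]
  rw [Matrix.mul_diagonal, Matrix.diagonal_mul, ← hL]
  -- Outside the supporting blocks both sides vanish, the left because the entries are zero and the
  -- right because of the indicators; the table is needed only inside.
  by_cases hi : p i; swap
  · simp [matBracket, hi, hA.left]
  by_cases hj : q j; swap
  · simp [matBracket, hj, hA.right]
  simp only [matBracket, Matrix.of_apply, hi, hj, if_true, one_mul, mul_one, Matrix.mul_diagonal,
    Matrix.diagonal_mul]
  refine Finset.sum_congr rfl fun k _ => Finset.sum_congr rfl fun l _ => ?_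
  by_cases hk : u k; swap
  · simp [hk, hB.left]
  by_cases hl : v l; swap
  · simp [hl, hB.right]
  simp [hk, hl, hD i j k l hi hj hk hl]

variable {m : ℕ} [NeZero m] {n d : Fin m → ℕ} {R : Type*} [CommRing R] (c : Coord n d → R)

theorem supportedOn_matX (s : Fin m) :
    SupportedOn (fun a => a.1 = s) (fun a => a.1 = s + 1) (matX c s) :=
  ⟨fun _ j h => matX_of_ne_left c h j, fun i _ h => matX_of_ne_right c h i⟩

theorem supportedOn_matY (s : Fin m) :
    SupportedOn (fun a => a.1 = s + 1) (fun a => a.1 = s) (matY c s) :=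
  ⟨fun _ j h => matY_of_ne_left c h j, fun i _ h => matY_of_ne_right c h i⟩

theorem supportedOn_matV (s : Fin m) (α : Fin (d s)) :
    SupportedOn (fun _ => True) (fun a => a.1 = s) (matV c s α) :=
  ⟨fun _ _ h => absurd trivial h, fun _ _ h => rowV_of_ne c h α⟩

theorem supportedOn_matW (s : Fin m) (α : Fin (d s)) :
    SupportedOn (fun a => a.1 = s) (fun _ => True) (matW c s α) :=
  ⟨fun _ _ h => colW_of_ne c h α, fun _ _ h => absurd trivial h⟩

end Entries

/-! ### Matrix form of the brackets of `X`, `Y`, `V`, `W`. -/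

section NormalForms

/-- Lets an identity for a product of two matrices be used inside a right-associated word. -/
theorem mul_mul_of_eq {R a b c d : Type*} [CommRing R] [Fintype b] [Fintype c] {A : Matrix a b R}
    {B : Matrix b c R} {C : Matrix a c R} (h : A * B = C) (M : Matrix c d R) :
    A * (B * M) = C * M := by
  rw [← Matrix.mul_assoc, h]

/-- With `c` a multiple of a Kronecker delta, the relation between the vertices may be assumed when
the matrices are compared. -/
theorem smul_congr_of_imp {M : Type*} [AddCommGroup M] [Module ℂ M] {P : Prop} {c : ℂ} {x y : M}
    (h0 : ¬P → c = 0) (h : P → x = y) : c • x = c • y := by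
  by_cases hP : P
  · rw [h hP]
  · rw [h0 hP, zero_smul, zero_smul]

variable {m : ℕ} [NeZero m] {n d : Fin m → ℕ}

local notation "𝐗" => matX (coord (n := n) (d := d))
local notation "𝐘" => matY (coord (n := n) (d := d))
local notation "𝐕" => matV (coord (n := n) (d := d))
local notation "𝐖" => matW (coord (n := n) (d := d))
local notation "𝐞" => proj n (CoordRing n d)

/-- In this and the following normal forms a projection survives only next to the arbitrary matrix
`Z`, where it records the block of a Kronecker delta; all others are absorbed by the coordinate
matrices. -/
theorem matBracket_XX (r s : Fin m) (Z : Matrix (Cyc n) (Cyc n) (CoordRing n d)) :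
    matBracket bracket (𝐗 r) (𝐗 s) Z =
      (1 / 2 * δ (s = r - 1) : ℂ) • (𝐞 r * Z * 𝐗 s * 𝐗 r)
      + (-(1 / 2 * δ (s = r + 1)) : ℂ) • (𝐗 r * 𝐗 s * Z * 𝐞 s) := by
  rw [matBracket_of_entries bracket (supportedOn_matX coord r) (supportedOn_matX coord s)
    [(1 / 2 * δ (s = r - 1), 𝐗 (r - 1) * 𝐗 r, 1),
      (-(1 / 2 * δ (s = r + 1)), 1, 𝐗 r * 𝐗 (r + 1))]]
  swap
  · rintro ⟨_, i⟩ ⟨_, j⟩ ⟨_, k⟩ ⟨_, l⟩ hi hj hk hl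
    subst_vars
    rw [matX_mk, matX_mk, bracket_coord, table]
    simp only [δ_eq_one_apply, δ_mul_eq_smul, List.map_cons, List.map_nil, List.sum_cons,
      List.sum_nil]
    module
  simp only [List.map_cons, List.map_nil, List.sum_cons, List.sum_nil, add_zero,
    indicatorMatrix_eq_proj, Matrix.one_mul]
  refine congrArg₂ (· + ·) (smul_congr_of_imp (P := s = r - 1) (by simp +contextual [δ]) ?_)
    (smul_congr_of_imp (P := s = r + 1) (by simp +contextual [δ]) ?_)
  · rintro rfl
    simp only [Matrix.mul_assoc, sub_add_cancel, mul_mul_of_eq (proj_mul_self _),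
      mul_mul_of_eq (proj_mul_matX _ _), matX_mul_proj]
  · rintro rfl
    simp only [Matrix.mul_assoc, mul_mul_of_eq (proj_mul_matX _ _), proj_mul_self,
      mul_mul_of_eq (matX_mul_proj _ _)]

theorem matBracket_YY (r s : Fin m) (Z : Matrix (Cyc n) (Cyc n) (CoordRing n d)) :
    matBracket bracket (𝐘 r) (𝐘 s) Z =
      (1 / 2 * δ (s = r - 1) : ℂ) • (𝐘 r * 𝐘 s * Z * 𝐞 r)
      + (-(1 / 2 * δ (s = r + 1)) : ℂ) • (𝐞 s * Z * 𝐘 s * 𝐘 r) := by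
  rw [matBracket_of_entries bracket (supportedOn_matY coord r) (supportedOn_matY coord s)
    [(1 / 2 * δ (s = r - 1), 1, 𝐘 r * 𝐘 (r - 1)),
      (-(1 / 2 * δ (s = r + 1)), 𝐘 (r + 1) * 𝐘 r, 1)]]
  swap
  · rintro ⟨_, i⟩ ⟨_, j⟩ ⟨_, k⟩ ⟨_, l⟩ hi hj hk hl
    subst_vars
    rw [matY_mk, matY_mk, bracket_coord, table]
    simp only [δ_eq_one_apply, δ_mul_eq_smul, List.map_cons, List.map_nil, List.sum_cons,
      List.sum_nil]
    module
  simp only [List.map_cons, List.map_nil, List.sum_cons, List.sum_nil, add_zero,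
    indicatorMatrix_eq_proj, Matrix.one_mul]
  refine congrArg₂ (· + ·) (smul_congr_of_imp (P := s = r - 1) (by simp +contextual [δ]) ?_)
    (smul_congr_of_imp (P := s = r + 1) (by simp +contextual [δ]) ?_)
  · rintro rfl
    simp only [Matrix.mul_assoc, sub_add_cancel, proj_mul_self, mul_mul_of_eq (proj_mul_matY _ _),
      mul_mul_of_eq (matY_mul_proj _ _)]
  · rintro rfl
    simp only [Matrix.mul_assoc, mul_mul_of_eq (proj_mul_matY _ _), matY_mul_proj,
      mul_mul_of_eq (proj_mul_self _)]

theorem matBracket_XY (r s : Fin m) (Z : Matrix (Cyc n) (Cyc n) (CoordRing n d)) :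
    matBracket bracket (𝐗 r) (𝐘 s) Z =
      (δ (s = r) : ℂ) • (𝐞 r * Z * 𝐞 (r + 1) + (1 / 2 : ℂ) • (𝐞 r * Z * 𝐘 r * 𝐗 r)
        + (1 / 2 : ℂ) • (𝐗 r * 𝐘 r * Z * 𝐞 (r + 1)))
      + (-(1 / 2 * δ (s = r - 1)) : ℂ) • (𝐘 s * Z * 𝐗 r)
      + (1 / 2 * δ (s = r + 1) : ℂ) • (𝐗 r * Z * 𝐘 s) := by
  rw [matBracket_of_entries bracket (supportedOn_matX coord r) (supportedOn_matY coord s)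
    [(δ (s = r), 1, 1),
      (1 / 2 * δ (s = r), 𝐘 r * 𝐗 r, 1),
      (1 / 2 * δ (s = r), 1, 𝐗 r * 𝐘 r),
      (-(1 / 2 * δ (s = r - 1)), 𝐗 r, 𝐘 (r - 1)),
      (1 / 2 * δ (s = r + 1), 𝐘 (r + 1), 𝐗 r)]]
  swap
  · rintro ⟨_, i⟩ ⟨_, j⟩ ⟨_, k⟩ ⟨_, l⟩ hi hj hk hl
    subst_vars
    rw [matX_mk, matY_mk, bracket_coord, table, tableXY]
    simp only [δ_eq_one_apply, δ_mul_eq_smul, List.map_cons, List.map_nil, List.sum_cons,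
      List.sum_nil]
    module
  simp only [List.map_cons, List.map_nil, List.sum_cons, List.sum_nil, add_zero,
    indicatorMatrix_eq_proj, Matrix.one_mul]
  simp only [← add_assoc]
  refine congrArg₂ (· + ·) (congrArg₂ (· + ·) ?_
    (smul_congr_of_imp (P := s = r - 1) (by simp +contextual [δ]) ?_))
    (smul_congr_of_imp (P := s = r + 1) (by simp +contextual [δ]) ?_)
  · by_cases h : s = r
    · subst h
      simp only [δ, if_true, mul_one, one_smul, Matrix.mul_assoc, mul_mul_of_eq (proj_mul_self _),
        proj_mul_self, mul_mul_of_eq (proj_mul_matX _ _), mul_mul_of_eq (proj_mul_matY _ _),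
        mul_mul_of_eq (matY_mul_proj _ _), matX_mul_proj]
    · simp [δ, h]
  · rintro rfl
    -- The target vertex of `Y_{r-1}` appears as `r - 1 + 1` and has to be rewritten as `r`.
    have h := proj_mul_matY (coord (n := n) (d := d)) (r - 1)
    rw [sub_add_cancel] at h
    simp only [Matrix.mul_assoc, sub_add_cancel, matX_mul_proj, proj_mul_matX, mul_mul_of_eq h,
      mul_mul_of_eq (matY_mul_proj _ _)]
  · rintro rfl
    simp only [Matrix.mul_assoc, mul_mul_of_eq (proj_mul_matX _ _), matY_mul_proj,
      mul_mul_of_eq (matX_mul_proj _ _), proj_mul_matY]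

theorem matBracket_YX (r s : Fin m) (Z : Matrix (Cyc n) (Cyc n) (CoordRing n d)) :
    matBracket bracket (𝐘 r) (𝐗 s) Z = -(
      (δ (r = s) : ℂ) • (𝐞 (s + 1) * Z * 𝐞 s + (1 / 2 : ℂ) • (𝐘 s * 𝐗 s * Z * 𝐞 s)
        + (1 / 2 : ℂ) • (𝐞 (s + 1) * Z * 𝐗 s * 𝐘 s))
      + (-(1 / 2 * δ (r = s - 1)) : ℂ) • (𝐗 s * Z * 𝐘 r)
      + (1 / 2 * δ (r = s + 1) : ℂ) • (𝐘 r * Z * 𝐗 s)) := by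
  refine matBracket_swap bracket bracket_antisymm (G := fun Z => -(
      (δ (r = s) : ℂ) • (𝐞 (s + 1) * Z * 𝐞 s + (1 / 2 : ℂ) • (𝐘 s * 𝐗 s * Z * 𝐞 s)
        + (1 / 2 : ℂ) • (𝐞 (s + 1) * Z * 𝐗 s * 𝐘 s))
      + (-(1 / 2 * δ (r = s - 1)) : ℂ) • (𝐗 s * Z * 𝐘 r)
      + (1 / 2 * δ (r = s + 1) : ℂ) • (𝐘 r * Z * 𝐗 s))) (fun Y Z => ?_) Z
  rw [matBracket_XY]
  simp only [Matrix.mul_add, Matrix.mul_smul, Matrix.mul_neg, Matrix.trace_add, Matrix.trace_neg,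
    Matrix.trace_smul, neg_neg]
  rw [trace_mul_sandwich Y (𝐞 s) Z (𝐞 (s + 1)), Matrix.mul_assoc (𝐞 s * Z),
    trace_mul_sandwich Y (𝐞 s) Z (𝐘 s * 𝐗 s), trace_mul_sandwich Y (𝐗 s * 𝐘 s) Z (𝐞 (s + 1)),
    trace_mul_sandwich Y (𝐘 r) Z, trace_mul_sandwich Y (𝐗 s) Z (𝐘 r),
    Matrix.mul_assoc (𝐞 (s + 1) * Y)]

theorem matBracket_XW (r s : Fin m) (β : Fin (d s)) (Z : Matrix Unit (Cyc n) (CoordRing n d)) :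
    matBracket bracket (𝐗 r) (𝐖 s β) Z =
      (1 / 2 * δ (s = r + 1) : ℂ) • (𝐗 r * 𝐖 s β * Z * 𝐞 s)
      + (-(1 / 2 * δ (r = s)) : ℂ) • (𝐖 s β * Z * 𝐗 r) := by
  rw [matBracket_of_entries bracket (supportedOn_matX coord r) (supportedOn_matW coord s β)
    [(1 / 2 * δ (s = r + 1), 1, 𝐗 r * 𝐖 s β),
      (-(1 / 2 * δ (r = s)), 𝐗 r, 𝐖 s β)]]
  swap
  · rintro ⟨_, i⟩ ⟨_, j⟩ ⟨_, k⟩ l hi hj hk hl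
    subst_vars
    rw [matX_mk, matW_apply, colW_mk, bracket_coord, table, tableXW]
    simp only [δ_eq_one_apply, δ_mul_eq_smul, mul_matW_apply, matW_apply, List.map_cons,
      List.map_nil, List.sum_cons, List.sum_nil]
    module
  simp only [List.map_cons, List.map_nil, List.sum_cons, List.sum_nil, add_zero,
    indicatorMatrix_eq_proj, indicatorMatrix_true, Matrix.one_mul]
  refine congrArg₂ (· + ·) (smul_congr_of_imp (P := s = r + 1) (by simp +contextual [δ]) ?_)
    (smul_congr_of_imp (P := r = s) (by simp +contextual [δ]) ?_)
  · rintro rfl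
    simp only [Matrix.mul_assoc, mul_mul_of_eq (proj_mul_matX _ _), proj_mul_self]
  · rintro rfl
    simp only [Matrix.mul_assoc, matX_mul_proj, proj_mul_matX, mul_mul_of_eq (proj_mul_matW _ _ _)]

theorem matBracket_XV (r s : Fin m) (β : Fin (d s)) (Z : Matrix (Cyc n) Unit (CoordRing n d)) :
    matBracket bracket (𝐗 r) (𝐕 s β) Z =
      (1 / 2 * δ (r = s) : ℂ) • (𝐞 s * Z * 𝐕 s β * 𝐗 r)
      + (-(1 / 2 * δ (s = r + 1)) : ℂ) • (𝐗 r * Z * 𝐕 s β) := by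
  rw [matBracket_of_entries bracket (supportedOn_matX coord r) (supportedOn_matV coord s β)
    [(1 / 2 * δ (r = s), 𝐕 s β * 𝐗 r, 1),
      (-(1 / 2 * δ (s = r + 1)), 𝐕 s β, 𝐗 r)]]
  swap
  · rintro ⟨_, i⟩ ⟨_, j⟩ k ⟨_, l⟩ hi hj hk hl
    subst_vars
    rw [matX_mk, matV_apply, rowV_mk, bracket_coord, table, tableXV]
    simp only [δ_eq_one_apply, δ_mul_eq_smul, matV_mul_apply, matV_apply, List.map_cons,
      List.map_nil, List.sum_cons, List.sum_nil]
    module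
  simp only [List.map_cons, List.map_nil, List.sum_cons, List.sum_nil, add_zero,
    indicatorMatrix_eq_proj, indicatorMatrix_true, Matrix.one_mul]
  refine congrArg₂ (· + ·) (smul_congr_of_imp (P := r = s) (by simp +contextual [δ]) ?_)
    (smul_congr_of_imp (P := s = r + 1) (by simp +contextual [δ]) ?_)
  · rintro rfl
    simp only [Matrix.mul_assoc, mul_mul_of_eq (proj_mul_self _), matX_mul_proj]
  · rintro rfl
    simp only [Matrix.mul_assoc, mul_mul_of_eq (proj_mul_matX _ _),
      mul_mul_of_eq (matX_mul_proj _ _), matV_mul_proj]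

theorem matBracket_YW (r s : Fin m) (β : Fin (d s)) (Z : Matrix Unit (Cyc n) (CoordRing n d)) :
    matBracket bracket (𝐘 r) (𝐖 s β) Z =
      (1 / 2 * δ (r = s) : ℂ) • (𝐘 r * 𝐖 s β * Z * 𝐞 s)
      + (-(1 / 2 * δ (s = r + 1)) : ℂ) • (𝐖 s β * Z * 𝐘 r) := by
  rw [matBracket_of_entries bracket (supportedOn_matY coord r) (supportedOn_matW coord s β)
    [(1 / 2 * δ (r = s), 1, 𝐘 r * 𝐖 s β),
      (-(1 / 2 * δ (s = r + 1)), 𝐘 r, 𝐖 s β)]]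
  swap
  · rintro ⟨_, i⟩ ⟨_, j⟩ ⟨_, k⟩ l hi hj hk hl
    subst_vars
    rw [matY_mk, matW_apply, colW_mk, bracket_coord, table, tableYW]
    simp only [δ_eq_one_apply, δ_mul_eq_smul, mul_matW_apply, matW_apply, List.map_cons,
      List.map_nil, List.sum_cons, List.sum_nil]
    module
  simp only [List.map_cons, List.map_nil, List.sum_cons, List.sum_nil, add_zero,
    indicatorMatrix_eq_proj, indicatorMatrix_true, Matrix.one_mul]
  refine congrArg₂ (· + ·) (smul_congr_of_imp (P := r = s) (by simp +contextual [δ]) ?_)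
    (smul_congr_of_imp (P := s = r + 1) (by simp +contextual [δ]) ?_)
  · rintro rfl
    simp only [Matrix.mul_assoc, mul_mul_of_eq (proj_mul_matY _ _), proj_mul_self]
  · rintro rfl
    simp only [Matrix.mul_assoc, matY_mul_proj, proj_mul_matY, mul_mul_of_eq (proj_mul_matW _ _ _)]

theorem matBracket_YV (r s : Fin m) (β : Fin (d s)) (Z : Matrix (Cyc n) Unit (CoordRing n d)) :
    matBracket bracket (𝐘 r) (𝐕 s β) Z =
      (1 / 2 * δ (s = r + 1) : ℂ) • (𝐞 s * Z * 𝐕 s β * 𝐘 r)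
      + (-(1 / 2 * δ (r = s)) : ℂ) • (𝐘 r * Z * 𝐕 s β) := by
  rw [matBracket_of_entries bracket (supportedOn_matY coord r) (supportedOn_matV coord s β)
    [(1 / 2 * δ (s = r + 1), 𝐕 s β * 𝐘 r, 1),
      (-(1 / 2 * δ (r = s)), 𝐕 s β, 𝐘 r)]]
  swap
  · rintro ⟨_, i⟩ ⟨_, j⟩ k ⟨_, l⟩ hi hj hk hl
    subst_vars
    rw [matY_mk, matV_apply, rowV_mk, bracket_coord, table, tableYV]
    simp only [δ_eq_one_apply, δ_mul_eq_smul, matV_mul_apply, matV_apply, List.map_cons,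
      List.map_nil, List.sum_cons, List.sum_nil]
    module
  simp only [List.map_cons, List.map_nil, List.sum_cons, List.sum_nil, add_zero,
    indicatorMatrix_eq_proj, indicatorMatrix_true, Matrix.one_mul]
  refine congrArg₂ (· + ·) (smul_congr_of_imp (P := s = r + 1) (by simp +contextual [δ]) ?_)
    (smul_congr_of_imp (P := r = s) (by simp +contextual [δ]) ?_)
  · rintro rfl
    simp only [Matrix.mul_assoc, mul_mul_of_eq (proj_mul_self _), matY_mul_proj]
  · rintro rfl
    simp only [Matrix.mul_assoc, mul_mul_of_eq (proj_mul_matY _ _),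
      mul_mul_of_eq (matY_mul_proj _ _), matV_mul_proj]

theorem matBracket_VV (r s : Fin m) (α : Fin (d r)) (β : Fin (d s))
    (Z : Matrix (Cyc n) Unit (CoordRing n d)) :
    matBracket bracket (𝐕 r α) (𝐕 s β) Z =
      (-(1 / 2 * ordSign r s) : ℂ) • (𝐕 s β * Z * 𝐕 r α)
      + (-(1 / 2 * (δ (r = s) * ordSign α β)) : ℂ) •
        (𝐕 r α * Z * 𝐕 s β + 𝐕 s β * Z * 𝐕 r α) := by
  rw [matBracket_of_entries bracket (supportedOn_matV coord r α) (supportedOn_matV coord s β)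
    [(-(1 / 2 * ordSign r s), 𝐕 r α, 𝐕 s β),
      (-(1 / 2 * (δ (r = s) * ordSign α β)), 𝐕 s β, 𝐕 r α),
      (-(1 / 2 * (δ (r = s) * ordSign α β)), 𝐕 r α, 𝐕 s β)]]
  swap
  · rintro i ⟨_, j⟩ k ⟨_, l⟩ hi hj hk hl
    subst_vars
    rw [matV_apply, rowV_mk, matV_apply, rowV_mk, bracket_coord, table]
    simp only [δ_mul_eq_smul, ordSign_mul_eq_smul, smul_mul_assoc, rowV_mk, matV_apply,
      List.map_cons, List.map_nil, List.sum_cons, List.sum_nil]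
    module
  simp only [List.map_cons, List.map_nil, List.sum_cons, List.sum_nil, add_zero,
    indicatorMatrix_eq_proj, indicatorMatrix_true, Matrix.one_mul]
  rw [smul_add]
  refine congrArg₂ (· + ·) ?_ (congrArg₂ (· + ·)
    (smul_congr_of_imp (P := r = s) (by simp +contextual [δ]) ?_) ?_)
  · simp only [Matrix.mul_assoc, matV_mul_proj, mul_mul_of_eq (matV_mul_proj _ _ _)]
  · rintro rfl
    simp only [Matrix.mul_assoc, matV_mul_proj, mul_mul_of_eq (matV_mul_proj _ _ _)]
  · simp only [Matrix.mul_assoc, matV_mul_proj, mul_mul_of_eq (matV_mul_proj _ _ _)]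

theorem matBracket_WW (r s : Fin m) (α : Fin (d r)) (β : Fin (d s))
    (Z : Matrix Unit (Cyc n) (CoordRing n d)) :
    matBracket bracket (𝐖 r α) (𝐖 s β) Z =
      (-(1 / 2 * ordSign r s) : ℂ) • (𝐖 r α * Z * 𝐖 s β)
      + (-(1 / 2 * (δ (r = s) * ordSign α β)) : ℂ) •
        (𝐖 r α * Z * 𝐖 s β + 𝐖 s β * Z * 𝐖 r α) := by
  rw [matBracket_of_entries bracket (supportedOn_matW coord r α) (supportedOn_matW coord s β)
    [(-(1 / 2 * ordSign r s), 𝐖 s β, 𝐖 r α),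
      (-(1 / 2 * (δ (r = s) * ordSign α β)), 𝐖 s β, 𝐖 r α),
      (-(1 / 2 * (δ (r = s) * ordSign α β)), 𝐖 r α, 𝐖 s β)]]
  swap
  · rintro ⟨_, i⟩ j ⟨_, k⟩ l hi hj hk hl
    subst_vars
    rw [matW_apply, colW_mk, matW_apply, colW_mk, bracket_coord, table]
    simp only [δ_mul_eq_smul, ordSign_mul_eq_smul, smul_mul_assoc, colW_mk, matW_apply,
      List.map_cons, List.map_nil, List.sum_cons, List.sum_nil]
    module
  simp only [List.map_cons, List.map_nil, List.sum_cons, List.sum_nil, add_zero,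
    indicatorMatrix_eq_proj, indicatorMatrix_true, Matrix.mul_one, Matrix.one_mul]
  rw [smul_add]
  refine congrArg₂ (· + ·) ?_ (congrArg₂ (· + ·) ?_
    (smul_congr_of_imp (P := r = s) (by simp +contextual [δ]) ?_))
  · simp only [Matrix.mul_assoc, proj_mul_matW, mul_mul_of_eq (proj_mul_matW _ _ _)]
  · simp only [Matrix.mul_assoc, proj_mul_matW, mul_mul_of_eq (proj_mul_matW _ _ _)]
  · rintro rfl
    simp only [Matrix.mul_assoc, proj_mul_matW, mul_mul_of_eq (proj_mul_matW _ _ _)]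

theorem matBracket_VW (r s : Fin m) (α : Fin (d r)) (β : Fin (d s))
    (Z : Matrix Unit (Cyc n) (CoordRing n d)) :
    matBracket bracket (𝐕 r α) (𝐖 s β) Z =
      (1 / 2 * ordSign r s : ℂ) • (Z * (𝐖 s β * 𝐕 r α))
      + (δ (r = s) : ℂ) • ((δ ((α : ℕ) = β) : ℂ) • (Z * 𝐞 s
          + (1 / 2 : ℂ) • (Z * (𝐖 s β * 𝐕 r α)) + (1 / 2 : ℂ) • (𝐕 r α * 𝐖 s β * Z * 𝐞 s))
        + (1 / 2 * ordSign α β : ℂ) • (𝐕 r α * 𝐖 s β * Z * 𝐞 s + Z * (𝐖 s β * 𝐕 r α))) := by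
  rw [matBracket_of_entries bracket (supportedOn_matV coord r α) (supportedOn_matW coord s β)
    [(1 / 2 * ordSign r s, 𝐖 s β * 𝐕 r α, 1),
      (δ (r = s) * δ ((α : ℕ) = β), 1, 1),
      (1 / 2 * (δ (r = s) * δ ((α : ℕ) = β)), 𝐖 s β * 𝐕 r α, 1),
      (1 / 2 * (δ (r = s) * δ ((α : ℕ) = β)), 1, 𝐕 r α * 𝐖 s β),
      (1 / 2 * (δ (r = s) * ordSign α β), 1, 𝐕 r α * 𝐖 s β),
      (1 / 2 * (δ (r = s) * ordSign α β), 𝐖 s β * 𝐕 r α, 1)]]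
  swap
  · rintro i ⟨_, j⟩ ⟨_, k⟩ l hi hj hk hl
    subst_vars
    rw [matV_apply, rowV_mk, matW_apply, colW_mk, bracket_coord, table, tableVW]
    simp only [δ_eq_one_apply, δ_mul_eq_smul, ordSign_mul_eq_smul, smul_mul_assoc, rowV_mk, colW_mk,
      matV_mul_matW_apply, matW_mul_matV_apply, mul_one, Matrix.one_apply_eq, List.map_cons,
      List.map_nil, List.sum_cons, List.sum_nil]
    module
  simp only [List.map_cons, List.map_nil, List.sum_cons, List.sum_nil, add_zero,
    indicatorMatrix_eq_proj, indicatorMatrix_true, Matrix.one_mul]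
  by_cases h : r = s
  · subst h
    simp only [Matrix.mul_assoc, proj_mul_self, mul_mul_of_eq (proj_mul_matW _ _ _), matV_mul_proj,
      δ, if_true]
    module
  · simp only [Matrix.mul_assoc, mul_mul_of_eq (proj_mul_matW _ _ _),
      matV_mul_proj, δ, h, if_false]
    module

theorem matBracket_WV (r s : Fin m) (α : Fin (d r)) (β : Fin (d s))
    (Z : Matrix (Cyc n) Unit (CoordRing n d)) :
    matBracket bracket (𝐖 r α) (𝐕 s β) Z = -(
      (1 / 2 * ordSign s r : ℂ) • (𝐖 r α * 𝐕 s β * Z)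
      + (δ (s = r) : ℂ) • ((δ ((β : ℕ) = α) : ℂ) • (𝐞 r * Z
          + (1 / 2 : ℂ) • (𝐖 r α * 𝐕 s β * Z) + (1 / 2 : ℂ) • (𝐞 r * Z * (𝐕 s β * 𝐖 r α)))
        + (1 / 2 * ordSign β α : ℂ) • (𝐞 r * Z * (𝐕 s β * 𝐖 r α) + 𝐖 r α * 𝐕 s β * Z))) := by
  refine matBracket_swap bracket bracket_antisymm (G := fun Z => -(
      (1 / 2 * ordSign s r : ℂ) • (𝐖 r α * 𝐕 s β * Z)
      + (δ (s = r) : ℂ) • ((δ ((β : ℕ) = α) : ℂ) • (𝐞 r * Z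
          + (1 / 2 : ℂ) • (𝐖 r α * 𝐕 s β * Z) + (1 / 2 : ℂ) • (𝐞 r * Z * (𝐕 s β * 𝐖 r α)))
        + (1 / 2 * ordSign β α : ℂ) • (𝐞 r * Z * (𝐕 s β * 𝐖 r α) + 𝐖 r α * 𝐕 s β * Z))))
    (fun Y Z => ?_) Z
  have h : ∀ M : Matrix (Cyc n) (Cyc n) (CoordRing n d),
      (Y * (Z * M)).trace = (Z * (M * Y)).trace := fun M => by
    rw [Matrix.trace_mul_comm, Matrix.mul_assoc]
  rw [matBracket_VW]
  simp only [Matrix.mul_add, Matrix.mul_smul, Matrix.mul_neg, Matrix.trace_add, Matrix.trace_neg,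
    Matrix.trace_smul, neg_neg]
  rw [h, h, trace_mul_sandwich Y (𝐕 s β * 𝐖 r α) Z (𝐞 r)]

end NormalForms

/-! ### Brackets between the factors `1 + YX` and `1 + WV`. -/

section Factors

variable {m : ℕ} [NeZero m] {n d : Fin m → ℕ}

local notation "𝐗" => matX (coord (n := n) (d := d))
local notation "𝐘" => matY (coord (n := n) (d := d))
local notation "𝐕" => matV (coord (n := n) (d := d))
local notation "𝐖" => matW (coord (n := n) (d := d))
local notation "𝐞" => proj n (CoordRing n d)

/-- The entries are the constants `0` and `1`, which derivations kill; so the identity summand of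
each factor drops out of brackets. -/
theorem matBracket_proj_left {a b : Type*} [Fintype a] [Fintype b] (s : Fin m)
    (B : Matrix a b (CoordRing n d)) (Z : Matrix b a (CoordRing n d)) :
    matBracket bracket (𝐞 s) B Z = 0 := by
  ext i j
  simp only [matBracket, Matrix.of_apply, Matrix.zero_apply]
  refine Finset.sum_eq_zero fun k _ => Finset.sum_eq_zero fun l _ => ?_
  rw [proj, Matrix.diagonal_apply]
  split_ifs <;> simp

theorem matBracket_proj_right {a b : Type*} [Fintype a] [Fintype b] (s : Fin m)
    (A : Matrix a b (CoordRing n d)) (Z : Matrix (Cyc n) (Cyc n) (CoordRing n d)) :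
    matBracket bracket A (𝐞 s) Z = 0 := by
  ext i j
  simp only [matBracket, Matrix.of_apply, Matrix.zero_apply]
  refine Finset.sum_eq_zero fun k _ => Finset.sum_eq_zero fun l _ => ?_
  rw [proj, Matrix.diagonal_apply]
  split_ifs <;> simp

/-- Terms arise only for adjacent vertices. They then act on the index summed over inside one of the
two products, and the contributions of its `X` and its `Y` cancel. -/
theorem matBracket_YX_YX_of_ne {r s : Fin m} (h : r ≠ s)
    (Z : Matrix (Cyc n) (Cyc n) (CoordRing n d)) :
    matBracket bracket (𝐘 r * 𝐗 r) (𝐘 s * 𝐗 s) Z = 0 := by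
  have e1 : (δ (r = s - 1) : ℂ) = δ (s = r + 1) := by simp [δ, eq_sub_iff_add_eq, eq_comm]
  have e2 : (δ (r = s + 1) : ℂ) = δ (s = r - 1) := by simp [δ, eq_sub_iff_add_eq, eq_comm]
  have e3 : (δ (s = r) : ℂ) = 0 := by simp [δ, h.symm]
  have e4 : (δ (r = s) : ℂ) = 0 := by simp [δ, h]
  rw [matBracket_mul_right, matBracket_mul_left, matBracket_mul_left, matBracket_XY, matBracket_XX,
    matBracket_YX, matBracket_YY, e1, e2, e3, e4]
  simp only [Matrix.mul_assoc, Matrix.mul_add, Matrix.add_mul, Matrix.mul_smul, Matrix.smul_mul,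
    Matrix.neg_mul, zero_smul, Matrix.mul_zero, Matrix.zero_mul, mul_mul_of_eq (matY_mul_proj _ _),
    matY_mul_proj, proj_mul_matX, mul_mul_of_eq (proj_mul_matX _ _)]
  module

/-- The product `Y_r X_r` lives at `r + 1`. The spin factors at `r` only see its inner index, on
which the contributions of `Y_r` and `X_r` cancel. -/
theorem matBracket_YX_WV_of_ne {r s : Fin m} (α : Fin (d s)) (h : s ≠ r + 1)
    (Z : Matrix (Cyc n) (Cyc n) (CoordRing n d)) :
    matBracket bracket (𝐘 r * 𝐗 r) (𝐖 s α * 𝐕 s α) Z = 0 := by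
  have e1 : (δ (s = r + 1) : ℂ) = 0 := by simp [δ, h]
  rw [matBracket_mul_right, matBracket_mul_left, matBracket_mul_left, matBracket_XW, matBracket_XV,
    matBracket_YW, matBracket_YV, e1]
  by_cases hrs : r = s
  · subst hrs
    simp only [Matrix.mul_assoc, Matrix.mul_add, Matrix.add_mul, Matrix.mul_smul, Matrix.smul_mul,
      mul_mul_of_eq (matY_mul_proj _ _), proj_mul_matX]
    module
  · simp [δ, hrs]

/-- Between different vertices only the order signs survive. They enter with opposite signs for `V`
and for `W`, hence cancel on each product `W V`. -/
theorem matBracket_WV_WV_of_ne {r s : Fin m} (α : Fin (d r)) (β : Fin (d s)) (h : r ≠ s)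
    (Z : Matrix (Cyc n) (Cyc n) (CoordRing n d)) :
    matBracket bracket (𝐖 r α * 𝐕 r α) (𝐖 s β * 𝐕 s β) Z = 0 := by
  have e3 : (δ (s = r) : ℂ) = 0 := by simp [δ, h.symm]
  have e4 : (δ (r = s) : ℂ) = 0 := by simp [δ, h]
  have e5 : (ordSign s r : ℂ) = -ordSign r s := by
    unfold ordSign
    split_ifs <;> first | omega | simp
  rw [matBracket_mul_right, matBracket_mul_left, matBracket_mul_left, matBracket_VV, matBracket_VW,
    matBracket_WV, matBracket_WW, e3, e4, e5]
  simp only [Matrix.mul_assoc, Matrix.mul_add, Matrix.add_mul, Matrix.mul_smul, Matrix.smul_mul,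
    Matrix.neg_mul, zero_smul, Matrix.mul_zero, Matrix.zero_mul]
  module

theorem isNestedPair_YX (hm : 2 ≤ m) (r : Fin m) :
    IsNestedPair bracket (𝐞 (r + 1)) (𝐞 (r + 1) + 𝐘 r * 𝐗 r) (𝐞 (r + 1) + 𝐘 r * 𝐗 r) := by
  intro Z
  -- Here `2 ≤ m` matters: for `m = 1` the arrows would be loops, and the terms for adjacent
  -- vertices would contribute.
  have e1 : (δ (r = r - 1) : ℂ) = 0 := by simp [δ, eq_sub_iff_add_eq]; omega
  have e2 : (δ (r = r + 1) : ℂ) = 0 := by simp [δ]; omega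
  have e3 : (δ (r = r) : ℂ) = 1 := by simp [δ]
  simp only [matBracket_add_left, matBracket_add_right, matBracket_proj_left, matBracket_proj_right,
    zero_add]
  rw [matBracket_mul_right, matBracket_mul_left, matBracket_mul_left, matBracket_XY, matBracket_XX,
    matBracket_YX, matBracket_YY, e1, e2, e3]
  simp only [Matrix.mul_assoc, Matrix.mul_add, Matrix.add_mul, Matrix.mul_smul, Matrix.smul_mul,
    Matrix.neg_mul, zero_smul, mul_zero, neg_zero, one_smul, Matrix.zero_mul, matY_mul_proj,
    mul_mul_of_eq (proj_mul_matX _ _), matX_mul_proj, mul_mul_of_eq (proj_mul_matY _ _),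
    proj_mul_self]
  module

theorem isNestedPair_WV (s : Fin m) (α : Fin (d s)) :
    IsNestedPair bracket (𝐞 s) (𝐞 s + 𝐖 s α * 𝐕 s α) (𝐞 s + 𝐖 s α * 𝐕 s α) := by
  intro Z
  have e3 : (δ (s = s) : ℂ) = 1 := by simp [δ]
  have e4 : (δ ((α : ℕ) = α) : ℂ) = 1 := by simp [δ]
  have e5 : ∀ k : ℕ, (ordSign k k : ℂ) = 0 := by simp [ordSign]
  simp only [matBracket_add_left, matBracket_add_right, matBracket_proj_left, matBracket_proj_right,
    zero_add]
  rw [matBracket_mul_right, matBracket_mul_left, matBracket_mul_left, matBracket_VV, matBracket_VW,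
    matBracket_WV, matBracket_WW, e3, e4, e5, e5]
  simp only [Matrix.mul_assoc, Matrix.mul_add, Matrix.add_mul, Matrix.mul_smul, Matrix.smul_mul,
    Matrix.neg_mul, zero_smul, mul_zero, neg_zero, one_smul, Matrix.mul_zero, Matrix.zero_mul,
    matV_mul_proj, mul_mul_of_eq (proj_mul_matW _ _ _), proj_mul_self]
  module

theorem isFusionPair_YX_WV (hm : 2 ≤ m) (r : Fin m) (α : Fin (d (r + 1))) :
    IsFusionPair bracket (𝐞 (r + 1)) (𝐞 (r + 1) + 𝐘 r * 𝐗 r)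
      (𝐞 (r + 1) + 𝐖 (r + 1) α * 𝐕 (r + 1) α) := by
  intro Z
  have e1 : (δ (r + 1 = r + 1) : ℂ) = 1 := by simp [δ]
  have e2 : (δ (r = r + 1) : ℂ) = 0 := by simp [δ]; omega
  simp only [matBracket_add_left, matBracket_add_right, matBracket_proj_left, matBracket_proj_right,
    zero_add]
  rw [matBracket_mul_right, matBracket_mul_left, matBracket_mul_left, matBracket_XW, matBracket_XV,
    matBracket_YW, matBracket_YV, e1, e2]
  simp only [Matrix.mul_assoc, Matrix.mul_add, Matrix.add_mul, Matrix.mul_smul, Matrix.smul_mul,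
    zero_smul, mul_zero, neg_zero, Matrix.zero_mul, matV_mul_proj,
    mul_mul_of_eq (proj_mul_matW _ _ _), proj_mul_self, matX_mul_proj,
    mul_mul_of_eq (proj_mul_matY _ _)]
  module

theorem isFusionPair_WV (s : Fin m) {α β : Fin (d s)} (h : α < β) :
    IsFusionPair bracket (𝐞 s) (𝐞 s + 𝐖 s α * 𝐕 s α) (𝐞 s + 𝐖 s β * 𝐕 s β) := by
  intro Z
  have h' : (α : ℕ) < β := h
  have e3 : (δ (s = s) : ℂ) = 1 := by simp [δ]
  have e4 : (δ ((α : ℕ) = β) : ℂ) = 0 := by simp [δ, h'.ne]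
  have e4' : (δ ((β : ℕ) = α) : ℂ) = 0 := by simp [δ, h'.ne']
  have e5 : (ordSign s s : ℂ) = 0 := by simp [ordSign]
  have e6 : (ordSign α β : ℂ) = 1 := by simp [ordSign, h]
  have e7 : (ordSign β α : ℂ) = -1 := by simp [ordSign, h, h.le]
  simp only [matBracket_add_left, matBracket_add_right, matBracket_proj_left, matBracket_proj_right,
    zero_add]
  rw [matBracket_mul_right, matBracket_mul_left, matBracket_mul_left, matBracket_VV, matBracket_VW,
    matBracket_WV, matBracket_WW, e3, e4, e4', e5, e6, e7]
  simp only [Matrix.mul_assoc, Matrix.mul_add, Matrix.add_mul, Matrix.mul_smul, Matrix.smul_mul,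
    Matrix.neg_mul, zero_smul, mul_zero, neg_zero, one_smul, Matrix.mul_zero, Matrix.zero_mul,
    matV_mul_proj, mul_mul_of_eq (proj_mul_matW _ _ _), proj_mul_self]
  module

end Factors

/-! ### Extension by zero from one vertex to `V_cyc`. -/

section Embed

variable {m : ℕ} {n : Fin m → ℕ} {R : Type*} [CommRing R]

/-- The extension by zero of an endomorphism of the summand at `s` to `V_cyc`. -/
def embed (s : Fin m) (M : Matrix (Fin (n s)) (Fin (n s)) R) : Matrix (Cyc n) (Cyc n) R :=
  Matrix.blockDiagonal' (Pi.single s M)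

theorem embed_mk (s : Fin m) (M : Matrix (Fin (n s)) (Fin (n s)) R) (i j : Fin (n s)) :
    embed s M ⟨s, i⟩ ⟨s, j⟩ = M i j := by
  rw [embed, Matrix.blockDiagonal'_apply_eq, Pi.single_eq_same]

theorem embed_of_ne_left {s : Fin m} (M : Matrix (Fin (n s)) (Fin (n s)) R) {a : Cyc n}
    (h : a.1 ≠ s) (b : Cyc n) : embed s M a b = 0 := by
  rw [embed, Matrix.blockDiagonal'_apply]
  simp [Pi.single_eq_of_ne h]

theorem embed_of_ne_right {s : Fin m} (M : Matrix (Fin (n s)) (Fin (n s)) R) {b : Cyc n}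
    (h : b.1 ≠ s) (a : Cyc n) : embed s M a b = 0 := by
  rw [embed, Matrix.blockDiagonal'_apply]
  split_ifs with hab
  · simp [Pi.single_eq_of_ne (hab ▸ h : a.1 ≠ s)]
  · rfl

theorem embed_mul (s : Fin m) (M N : Matrix (Fin (n s)) (Fin (n s)) R) :
    embed s (M * N) = embed s M * embed s N := by
  rw [embed, embed, embed, ← Matrix.blockDiagonal'_mul]
  congr 1
  exact Pi.single_mul (α := fun s => Matrix (Fin (n s)) (Fin (n s)) R) s M N

theorem embed_add (s : Fin m) (M N : Matrix (Fin (n s)) (Fin (n s)) R) :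
    embed s (M + N) = embed s M + embed s N := by
  rw [embed, embed, embed, ← Matrix.blockDiagonal'_add, Pi.single_add]

theorem embed_one (s : Fin m) : embed s (1 : Matrix (Fin (n s)) (Fin (n s)) R) = proj n R s := by
  ext ⟨a, i⟩ b
  by_cases h : a = s
  · subst h
    by_cases hb : b.1 = a
    · obtain ⟨_, j⟩ := b
      obtain rfl := hb
      rw [embed_mk]
      simp [proj, Matrix.diagonal_apply, Matrix.one_apply]
    · rw [embed_of_ne_right _ hb]
      have : (⟨a, i⟩ : Cyc n) ≠ b := by rintro rfl; exact hb rfl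
      simp [proj, this]
  · rw [embed_of_ne_left _ h]
    simp [proj, Matrix.diagonal_apply, h]

theorem inCorner_embed (s : Fin m) (M : Matrix (Fin (n s)) (Fin (n s)) R) :
    InCorner (proj n R s) (embed s M) := by
  rw [← embed_one]
  exact ⟨by rw [← embed_mul, one_mul], by rw [← embed_mul, mul_one]⟩

theorem embed_block (s : Fin m) {N : Matrix (Cyc n) (Cyc n) R} (h : InCorner (proj n R s) N) :
    embed s (block s N) = N := by
  ext a b
  by_cases ha : a.1 = s; swap
  · rw [embed_of_ne_left _ ha, ← h.left, proj, Matrix.diagonal_mul]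
    simp [ha]
  by_cases hb : b.1 = s; swap
  · rw [embed_of_ne_right _ hb, ← h.right, proj, Matrix.mul_diagonal]
    simp [hb]
  obtain ⟨_, i⟩ := a
  obtain rfl := ha
  obtain ⟨_, j⟩ := b
  obtain rfl := hb
  rw [embed_mk]
  rfl

theorem trace_embed (s : Fin m) (M : Matrix (Fin (n s)) (Fin (n s)) R) :
    (embed s M).trace = M.trace := by
  rw [embed, Matrix.trace_blockDiagonal', Finset.sum_eq_single s]
  · rw [Pi.single_eq_same]
  · intro t _ ht
    rw [Pi.single_eq_of_ne ht, Matrix.trace_zero]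
  · simp

theorem embed_map (s : Fin m) (M : Matrix (Fin (n s)) (Fin (n s)) R) (f : R → R) (hf : f 0 = 0) :
    (embed s M).map f = embed s (M.map f) := by
  ext a b
  rw [Matrix.map_apply]
  by_cases ha : a.1 = s; swap
  · rw [embed_of_ne_left _ ha, embed_of_ne_left _ ha, hf]
  by_cases hb : b.1 = s; swap
  · rw [embed_of_ne_right _ hb, embed_of_ne_right _ hb, hf]
  obtain ⟨_, i⟩ := a
  obtain rfl := ha
  obtain ⟨_, j⟩ := b
  obtain rfl := hb
  rw [embed_mk, embed_mk, Matrix.map_apply]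

theorem sum_embed (M : ∀ s, Matrix (Fin (n s)) (Fin (n s)) R) :
    ∑ s, embed s (M s) = Matrix.blockDiagonal' M := by
  conv_rhs => rw [← Finset.univ_sum_single M]
  exact (map_sum (Matrix.blockDiagonal'AddMonoidHom (fun s => Fin (n s)) (fun s => Fin (n s)) R)
    (fun s => Pi.single s (M s)) Finset.univ).symm

end Embed

/-! ### Differentials of traces of inverse powers. -/

section DerivationTrace

variable {R : Type*} [CommRing R] [Algebra ℂ R] {ι : Type*} [Fintype ι] [DecidableEq ι]
  (D : Derivation ℂ R R)

theorem map_derivation_mul (A B : Matrix ι ι R) :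
    (A * B).map D = A.map D * B + A * B.map D := by
  ext i j
  simp only [Matrix.map_apply, Matrix.mul_apply, Matrix.add_apply, map_sum, Derivation.leibniz,
    smul_eq_mul, ← Finset.sum_add_distrib]
  refine Finset.sum_congr rfl fun k _ => ?_
  ring

theorem map_derivation_one : (1 : Matrix ι ι R).map D = 0 := by
  ext i j
  rw [Matrix.map_apply, Matrix.one_apply]
  split_ifs <;> simp

theorem map_derivation_of_mul_eq_one {u w : Matrix ι ι R} (h : w * u = 1) (h' : u * w = 1) :
    w.map D = -(w * u.map D * w) := by
  have h1 := map_derivation_mul D w u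
  rw [h, map_derivation_one] at h1
  have h2 : w.map D * u = -(w * u.map D) := (neg_eq_of_add_eq_zero_left h1.symm).symm
  rw [← mul_one (w.map D), ← h', ← mul_assoc, h2, neg_mul]

/-- The commuting matrix `M` makes the induction close: peeling off one factor `w` replaces `M` by
`w * M`. The exponent is `k + 1` because `dw = -w du w` has one more `w` than it replaces. -/
theorem trace_mul_map_derivation_pow {u w : Matrix ι ι R} (h : w * u = 1) (h' : u * w = 1) (k : ℕ)
    {M : Matrix ι ι R} (hM : M * w = w * M) :
    (M * (w ^ k).map D).trace = -(k * (M * w ^ (k + 1) * u.map D).trace) := by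
  induction k generalizing M with
  | zero => simp [map_derivation_one]
  | succ k ih =>
    have h1 : (M * ((w ^ k).map D * w)).trace = (w * M * (w ^ k).map D).trace := by
      rw [← mul_assoc, Matrix.trace_mul_comm, mul_assoc]
    have h2 : (M * (w ^ k * (w * u.map D * w))).trace =
        (M * w ^ (k + 1 + 1) * u.map D).trace := by
      rw [← mul_assoc, ← mul_assoc, Matrix.trace_mul_comm, ← mul_assoc, ← mul_assoc w, ← hM,
        ← mul_assoc, pow_succ' w (k + 1), pow_succ w k]
      simp only [mul_assoc]
    rw [pow_succ w k, map_derivation_mul, mul_add, Matrix.trace_add, h1,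
      ih (by rw [mul_assoc, hM]), map_derivation_of_mul_eq_one D h h', mul_neg, mul_neg,
      Matrix.trace_neg, h2, ← hM, mul_assoc M w, ← pow_succ']
    push_cast
    ring

theorem derivation_trace_pow {u w : Matrix ι ι R} (h : w * u = 1) (h' : u * w = 1) (k : ℕ) :
    D (w ^ k).trace = ((-(k : R)) • w ^ (k + 1) * u.map D).trace := by
  have := trace_mul_map_derivation_pow D h h' k (M := 1) (by simp)
  rw [one_mul, one_mul] at this
  rw [smul_mul_assoc, Matrix.trace_smul, smul_eq_mul, neg_mul, ← this]
  simp [Matrix.trace, map_sum]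

/-- If the differentials of `f` and `g` are those of invariant functions of `U` and `U'`, then
`{f, g}` is a contraction of the brackets of the entries of `U` with those of `U'`. -/
theorem bracket_eq_trace {D : Derivation ℂ R (Derivation ℂ R R)} (hD : ∀ f g, D f g = -D g f)
    {κ : Type*} [Fintype κ] {U G : Matrix ι ι R} {U' G' : Matrix κ κ R} {f g : R}
    (hf : ∀ E : Derivation ℂ R R, E f = (G * U.map E).trace)
    (hg : ∀ E : Derivation ℂ R R, E g = (G' * U'.map E).trace) :
    D f g = (G * matBracket D U U' G').trace := by
  -- The hypothesis on `f` concerns derivations applied to `f`, while here `f` sits in the first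
  -- slot; antisymmetry reduces this to the derivation `D x`.
  have h : ∀ x, D f x = (G * U.map fun y => D y x).trace := by
    intro x
    rw [hD, hf (D x)]
    simp only [Matrix.trace, Matrix.diag_apply, Matrix.mul_apply, Matrix.map_apply,
      ← Finset.sum_neg_distrib]
    refine Finset.sum_congr rfl fun i _ => Finset.sum_congr rfl fun j _ => ?_
    rw [hD x]
    ring
  rw [hg (D f), trace_mul_matBracket, sum_sum_comm]
  simp only [Matrix.trace, Matrix.diag_apply, Matrix.mul_apply, Matrix.map_apply] at h ⊢
  rw [Finset.sum_comm]
  refine Finset.sum_congr rfl fun k _ => Finset.sum_congr rfl fun l _ => ?_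
  rw [h, Finset.sum_comm, Finset.mul_sum]
  refine Finset.sum_congr rfl fun i _ => ?_
  rw [Finset.mul_sum]
  refine Finset.sum_congr rfl fun j _ => ?_
  ring

end DerivationTrace

/-! ### Invertibility of the factors on `M^•`. -/

section Localization

variable {m : ℕ} [NeZero m] {n d : Fin m → ℕ}

theorem map_matX {R S : Type*} [CommRing R] [CommRing S] (f : R →+* S) (c : Coord n d → R)
    (s : Fin m) : (matX c s).map f = matX (fun g => f (c g)) s := by
  ext a b
  simp [matX, Matrix.sum_apply, Matrix.single_apply, apply_ite f]

theorem map_matY {R S : Type*} [CommRing R] [CommRing S] (f : R →+* S) (c : Coord n d → R)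
    (s : Fin m) : (matY c s).map f = matY (fun g => f (c g)) s := by
  ext a b
  simp [matY, Matrix.sum_apply, Matrix.single_apply, apply_ite f]

theorem map_rowV {R S : Type*} [CommRing R] [CommRing S] (f : R →+* S) (c : Coord n d → R)
    (s : Fin m) (α : Fin (d s)) (a : Cyc n) :
    f (rowV c s α a) = rowV (fun g => f (c g)) s α a := by
  simp [rowV, Finset.sum_apply, Pi.single_apply, apply_ite f]

theorem map_colW {R S : Type*} [CommRing R] [CommRing S] (f : R →+* S) (c : Coord n d → R)
    (s : Fin m) (α : Fin (d s)) (a : Cyc n) :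
    f (colW c s α a) = colW (fun g => f (c g)) s α a := by
  simp [colW, Finset.sum_apply, Pi.single_apply, apply_ite f]

theorem map_one_add_block {R S : Type*} [CommRing R] [CommRing S] (f : R →+* S) (s : Fin m)
    (M : Matrix (Cyc n) (Cyc n) R) : (1 + block s M).map f = 1 + block s (M.map f) := by
  rw [Matrix.map_add f (map_add f), Matrix.map_one f (map_zero f) (map_one f)]
  rfl

theorem isUnit_det_of_map {κ : Type*} [Fintype κ] [DecidableEq κ]
    {M : Matrix κ κ (MvPolynomial (Coord n d) ℂ)} {N : Matrix κ κ (CoordRing n d)}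
    (hM : M.det ∈ nonvanishing n d)
    (h : M.map (algebraMap (MvPolynomial (Coord n d) ℂ) (CoordRing n d)) = N) :
    IsUnit N.det := by
  rw [← h, ← RingHom.mapMatrix_apply, ← RingHom.map_det]
  exact IsLocalization.map_units (CoordRing n d)
    (⟨M.det, Submonoid.subset_closure hM⟩ : Submonoid.closure (nonvanishing n d))

theorem isUnit_det_oneXY (s : Fin m) : IsUnit (oneXY (coord (n := n) (d := d)) s).det := by
  refine isUnit_det_of_map (Or.inl ⟨s, rfl⟩) ?_
  rw [oneXY, map_one_add_block, Matrix.map_mul, map_matX, map_matY]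
  rfl

theorem isUnit_det_oneYX (s : Fin m) : IsUnit (oneYX (coord (n := n) (d := d)) s).det := by
  refine isUnit_det_of_map (Or.inr (Or.inl ⟨s, rfl⟩)) ?_
  rw [oneYX, map_one_add_block, Matrix.map_mul, map_matX, map_matY]
  rfl

theorem isUnit_det_oneWV (p : Σ s, Fin (d s)) :
    IsUnit (oneWV (coord (n := n) (d := d)) p.1 p).det := by
  refine isUnit_det_of_map (Or.inr (Or.inr (Or.inl ⟨p.1, p.2, rfl⟩))) ?_
  rw [oneWV, map_one_add_block]
  congr 2
  ext a b
  rw [Matrix.map_apply, Matrix.vecMulVec_apply, Matrix.vecMulVec_apply, map_mul, map_colW, map_rowV]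
  rfl

end Localization

/-! ### The chain of moment products at each vertex. -/

section Chain

variable {m : ℕ} [NeZero m] {n d : Fin m → ℕ}

local notation "𝐗" => matX (coord (n := n) (d := d))
local notation "𝐘" => matY (coord (n := n) (d := d))
local notation "𝐕" => matV (coord (n := n) (d := d))
local notation "𝐖" => matW (coord (n := n) (d := d))
local notation "𝐞" => proj n (CoordRing n d)

variable (n d) in
/-- The product of `Id + Y_{s-1} X_{s-1}` and of the factors `Id + W_p V_p` at the vertex `s`, for
`p` among the first `b` spin indices. -/
noncomputable def momentProduct : ℕ → (s : Fin m) → Matrix (Fin (n s)) (Fin (n s)) (CoordRing n d)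
  | 0, s => oneYX coord s
  | c + 1, s =>
      if h : c < ∑ s, d s then
        if (ofLex (ρ d ⟨c, h⟩)).1 = s then oneWV coord s (ofLex (ρ d ⟨c, h⟩)) * momentProduct c s
        else momentProduct c s
      else momentProduct c s

/-- Inversion reverses products: `Φ` grows by inverses on the right, so `momentProduct` grows on the
left. -/
theorem Φ_eq (b : ℕ) (s : Fin m) :
    Φ n d b s = oneXY coord s * (momentProduct n d b s)⁻¹ := by
  induction b with
  | zero => rfl
  | succ b ih =>
    rw [Φ, momentProduct]
    split_ifs
    · rw [ih, Matrix.mul_inv_rev, Matrix.mul_assoc]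
    · exact ih
    · exact ih

theorem isUnit_det_momentProduct (b : ℕ) (s : Fin m) : IsUnit (momentProduct n d b s).det := by
  induction b with
  | zero => exact isUnit_det_oneYX s
  | succ b ih =>
    rw [momentProduct]
    split_ifs with h1 h2
    · subst h2
      rw [Matrix.det_mul]
      exact (isUnit_det_oneWV _).mul ih
    · exact ih
    · exact ih

variable (n) in
/-- `Id + W_p V_p` as an endomorphism of the summand of `V_cyc` at the vertex of `p`. -/
noncomputable def spinFactor (p : Σ s, Fin (d s)) : Matrix (Cyc n) (Cyc n) (CoordRing n d) :=
  𝐞 p.1 + 𝐖 p.1 p.2 * 𝐕 p.1 p.2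

theorem inCorner_WV (s : Fin m) (α : Fin (d s)) : InCorner (𝐞 s) (𝐖 s α * 𝐕 s α) :=
  ⟨by rw [← Matrix.mul_assoc, proj_mul_matW], by rw [Matrix.mul_assoc, matV_mul_proj]⟩

theorem inCorner_YX (r : Fin m) : InCorner (𝐞 (r + 1)) (𝐘 r * 𝐗 r) :=
  ⟨by rw [← Matrix.mul_assoc, proj_mul_matY], by rw [Matrix.mul_assoc, matX_mul_proj]⟩

theorem inCorner_XY (r : Fin m) : InCorner (𝐞 r) (𝐗 r * 𝐘 r) :=
  ⟨by rw [← Matrix.mul_assoc, proj_mul_matX], by rw [Matrix.mul_assoc, matY_mul_proj]⟩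

theorem inCorner_spinFactor (p : Σ s, Fin (d s)) : InCorner (𝐞 p.1) (spinFactor n p) := by
  have h := inCorner_WV (n := n) p.1 p.2
  exact ⟨by rw [spinFactor, Matrix.mul_add, h.left, proj_mul_self],
    by rw [spinFactor, Matrix.add_mul, h.right, proj_mul_self]⟩

theorem embed_oneYX (r : Fin m) :
    embed (r + 1) (oneYX (coord (n := n) (d := d)) (r + 1)) = 𝐞 (r + 1) + 𝐘 r * 𝐗 r := by
  rw [oneYX, embed_add, embed_one, add_sub_cancel_right, embed_block _ (inCorner_YX r)]

theorem embed_oneXY (s : Fin m) :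
    embed s (oneXY (coord (n := n) (d := d)) s) = 𝐞 s + 𝐗 s * 𝐘 s := by
  rw [oneXY, embed_add, embed_one, embed_block _ (inCorner_XY s)]

theorem embed_oneWV (p : Σ s, Fin (d s)) :
    embed p.1 (oneWV (coord (n := n)) p.1 p) = spinFactor n p := by
  have h : Matrix.vecMulVec (colW coord p.1 p.2) (rowV coord p.1 p.2) = 𝐖 p.1 p.2 * 𝐕 p.1 p.2 := by
    ext a b
    rw [matW_mul_matV_apply, Matrix.vecMulVec_apply]
  rw [oneWV, embed_add, embed_one, h, embed_block _ (inCorner_WV _ _), spinFactor]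

theorem embed_momentProduct_zero (r : Fin m) :
    embed (r + 1) (momentProduct n d 0 (r + 1)) = 𝐞 (r + 1) + 𝐘 r * 𝐗 r :=
  embed_oneYX r

/-- The form in which every induction on the chain proceeds: a step either does nothing at `s` or
multiplies by a spin factor living at `s`. -/
theorem embed_momentProduct_succ (b : ℕ) (s : Fin m) :
    embed s (momentProduct n d (b + 1) s) = embed s (momentProduct n d b s) ∨
      ∃ h : b < ∑ s, d s, (ofLex (ρ d ⟨b, h⟩)).1 = s ∧
        embed s (momentProduct n d (b + 1) s) =
          spinFactor n (ofLex (ρ d ⟨b, h⟩)) * embed s (momentProduct n d b s) := by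
  rw [momentProduct]
  split_ifs with h1 h2
  · subst h2
    exact Or.inr ⟨h1, rfl, by rw [embed_mul, embed_oneWV]⟩
  · exact Or.inl rfl
  · exact Or.inl rfl

theorem isFusionPair_spinFactor {p q : Σ s, Fin (d s)} (hs : p.1 = q.1)
    (h : toLex p < toLex q) :
    IsFusionPair bracket (𝐞 q.1) (spinFactor n p) (spinFactor n q) := by
  obtain ⟨s, α⟩ := p
  obtain ⟨t, β⟩ := q
  obtain rfl : s = t := hs
  refine isFusionPair_WV s ?_
  rw [Sigma.Lex.lt_def] at h
  rcases h with h | ⟨_, h⟩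
  · exact absurd h (lt_irrefl _)
  · exact h

/-- Indices start at zero: the product contains only factors of index less than `b`, so the factor
of index `q` comes after all of them, even when `q = b`. -/
theorem isFusionPair_momentProduct (hm : 2 ≤ m) (b : ℕ) (q : Fin (∑ s, d s)) (hb : b ≤ q) :
    IsFusionPair bracket (𝐞 (ofLex (ρ d q)).1)
      (embed _ (momentProduct n d b (ofLex (ρ d q)).1)) (spinFactor n (ofLex (ρ d q))) := by
  induction b with
  | zero =>
    generalize ofLex (ρ d q) = p
    obtain ⟨s, α⟩ := p
    obtain ⟨r, rfl⟩ : ∃ r, r + 1 = s := ⟨s - 1, sub_add_cancel s 1⟩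
    rw [embed_momentProduct_zero]
    exact isFusionPair_YX_WV hm r α
  | succ b ih =>
    have ih := ih (by omega)
    rcases embed_momentProduct_succ (n := n) b (ofLex (ρ d q)).1 with h | ⟨hb', hs, h⟩
    · rwa [h]
    · rw [h]
      -- The enumeration is increasing for the lexicographic order, which at a fixed vertex is the
      -- order of the spins; this fixes the direction of the fusion bracket.
      have hlt : ρ d ⟨b, hb'⟩ < ρ d q := (ρ d).lt_iff_lt.mpr (by exact hb)
      refine (isFusionPair_spinFactor hs hlt).mul_left ih ?_ (inCorner_embed _ _)
      rw [← hs]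
      exact inCorner_spinFactor _

theorem isNestedPair_spinFactor (p : Σ s, Fin (d s)) :
    IsNestedPair bracket (𝐞 p.1) (spinFactor n p) (spinFactor n p) :=
  isNestedPair_WV p.1 p.2

theorem isNestedPair_momentProduct_self (hm : 2 ≤ m) (b : ℕ) (s : Fin m) :
    IsNestedPair bracket (𝐞 s) (embed s (momentProduct n d b s))
      (embed s (momentProduct n d b s)) := by
  induction b with
  | zero =>
    obtain ⟨r, rfl⟩ : ∃ r, r + 1 = s := ⟨s - 1, sub_add_cancel s 1⟩
    rw [embed_momentProduct_zero]
    exact isNestedPair_YX hm r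
  | succ b ih =>
    rcases embed_momentProduct_succ (n := n) (d := d) b s with h | ⟨hb, rfl, h⟩
    · rwa [h]
    · rw [h]
      exact IsNestedPair.self_mul bracket_antisymm (inCorner_embed _ _) (inCorner_spinFactor _) ih
        (isNestedPair_spinFactor _) (isFusionPair_momentProduct hm b ⟨b, hb⟩ le_rfl)

theorem isNestedPair_momentProduct (hm : 2 ≤ m) {b c : ℕ} (hbc : b ≤ c) (s : Fin m) :
    IsNestedPair bracket (𝐞 s) (embed s (momentProduct n d b s))
      (embed s (momentProduct n d c s)) := by
  induction c, hbc using Nat.le_induction with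
  | base => exact isNestedPair_momentProduct_self hm b s
  | succ c hbc ih =>
    rcases embed_momentProduct_succ (n := n) (d := d) c s with h | ⟨hc, rfl, h⟩
    · rwa [h]
    · rw [h]
      exact ih.mul_right (isFusionPair_momentProduct hm b ⟨c, hc⟩ hbc) (inCorner_embed _ _)
        (inCorner_spinFactor _)

theorem matBracket_mul_left_eq_zero {κ : Type*} [Fintype κ]
    {A A' : Matrix (Cyc n) (Cyc n) (CoordRing n d)} {B : Matrix κ κ (CoordRing n d)}
    (h : ∀ Z, matBracket bracket A B Z = 0) (h' : ∀ Z, matBracket bracket A' B Z = 0) (Z : Matrix κ κ (CoordRing n d)) :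
    matBracket bracket (A * A') B Z = 0 := by
  rw [matBracket_mul_left, h, h', Matrix.mul_zero, Matrix.zero_mul, add_zero]

theorem matBracket_eq_zero_swap {A B : Matrix (Cyc n) (Cyc n) (CoordRing n d)}
    (h : ∀ Z, matBracket bracket A B Z = 0) (Z : Matrix (Cyc n) (Cyc n) (CoordRing n d)) :
    matBracket bracket B A Z = 0 :=
  matBracket_swap bracket bracket_antisymm (G := fun _ => 0) (fun Y Z => by simp [h]) Z

theorem matBracket_momentProduct_spinFactor {s : Fin m} {p : Σ s, Fin (d s)} (h : s ≠ p.1) (b : ℕ)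
    (Z : Matrix (Cyc n) (Cyc n) (CoordRing n d)) :
    matBracket bracket (embed s (momentProduct n d b s)) (spinFactor n p) Z = 0 := by
  induction b generalizing Z with
  | zero =>
    obtain ⟨r, rfl⟩ : ∃ r, r + 1 = s := ⟨s - 1, sub_add_cancel s 1⟩
    simp only [embed_momentProduct_zero, spinFactor, matBracket_add_left, matBracket_add_right,
      matBracket_proj_left, matBracket_proj_right, zero_add]
    exact matBracket_YX_WV_of_ne _ h.symm Z
  | succ b ih =>
    rcases embed_momentProduct_succ (n := n) (d := d) b s with h' | ⟨_, rfl, h'⟩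
    · rw [h', ih]
    · rw [h']
      refine matBracket_mul_left_eq_zero (fun Z => ?_) ih Z
      simp only [spinFactor, matBracket_add_left, matBracket_add_right, matBracket_proj_left,
        matBracket_proj_right, zero_add]
      exact matBracket_WV_WV_of_ne _ _ h Z

/-- All factors at `r` commute with all factors at `s`, and vanishing of brackets passes to
products. The slots are swapped so that the product being decomposed is always the first one. -/
theorem matBracket_momentProduct_of_ne {r s : Fin m} (h : r ≠ s) (b c : ℕ)
    (Z : Matrix (Cyc n) (Cyc n) (CoordRing n d)) :
    matBracket bracket (embed r (momentProduct n d b r)) (embed s (momentProduct n d c s)) Z =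
      0 := by
  induction b generalizing Z with
  | zero =>
    refine matBracket_eq_zero_swap (fun Z => ?_) Z
    induction c generalizing Z with
    | zero =>
      obtain ⟨r, rfl⟩ : ∃ t, t + 1 = r := ⟨r - 1, sub_add_cancel r 1⟩
      obtain ⟨s, rfl⟩ : ∃ t, t + 1 = s := ⟨s - 1, sub_add_cancel s 1⟩
      simp only [embed_momentProduct_zero, matBracket_add_left, matBracket_add_right,
        matBracket_proj_left, matBracket_proj_right, zero_add]
      exact matBracket_YX_YX_of_ne (fun h' => h (by rw [h'])) Z
    | succ c ih =>
      rcases embed_momentProduct_succ (n := n) (d := d) c s with h' | ⟨_, rfl, h'⟩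
      · rw [h', ih]
      · rw [h']
        exact matBracket_mul_left_eq_zero
          (matBracket_eq_zero_swap (matBracket_momentProduct_spinFactor h 0)) ih Z
  | succ b ih =>
    rcases embed_momentProduct_succ (n := n) (d := d) b r with h' | ⟨_, rfl, h'⟩
    · rw [h', ih]
    · rw [h']
      exact matBracket_mul_left_eq_zero
        (matBracket_eq_zero_swap (matBracket_momentProduct_spinFactor h.symm c)) ih Z

end Chain

/-! ### Commutation of the generators and the two algebras. -/

section Generators

variable {m : ℕ} [NeZero m] {n d : Fin m → ℕ}

theorem trace_conj_pow {R κ : Type*} [CommRing R] [Fintype κ] [DecidableEq κ] {T w : Matrix κ κ R}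
    (hT : IsUnit T.det) (k : ℕ) : ((T * w * T⁻¹) ^ k).trace = (w ^ k).trace := by
  have h : (T * w * T⁻¹) ^ k = T * w ^ k * T⁻¹ := by
    induction k with
    | zero => simp [Matrix.mul_nonsing_inv T hT]
    | succ k ih =>
      rw [pow_succ, ih, pow_succ]
      simp only [← mul_assoc]
      rw [Matrix.nonsing_inv_mul_cancel_right _ _ hT]
  rw [h, Matrix.trace_mul_comm, ← mul_assoc, Matrix.nonsing_inv_mul T hT, one_mul]

theorem trace_Φ_pow (b k : ℕ) (s : Fin m) :
    ((Φ n d b s * (oneXY coord s)⁻¹) ^ k).trace = ((momentProduct n d b s)⁻¹ ^ k).trace := by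
  rw [Φ_eq, trace_conj_pow (isUnit_det_oneXY s)]

/-- Supplies the input of `bracket_eq_trace`: the contracting matrix is a multiple of a power of the
inverse, hence commutes with the moment product. -/
theorem derivation_trace_momentProduct_inv_pow (b k : ℕ) (s : Fin m)
    (E : Derivation ℂ (CoordRing n d) (CoordRing n d)) :
    E ((momentProduct n d b s)⁻¹ ^ k).trace =
      (embed s ((-(k : CoordRing n d)) • (momentProduct n d b s)⁻¹ ^ (k + 1)) *
        (embed s (momentProduct n d b s)).map E).trace := by
  have hu := isUnit_det_momentProduct (n := n) (d := d) b s
  rw [embed_map _ _ _ (map_zero E), ← embed_mul, trace_embed,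
    derivation_trace_pow E (Matrix.nonsing_inv_mul _ hu) (Matrix.mul_nonsing_inv _ hu)]

theorem bracket_trace_momentProduct_inv_pow (hm : 2 ≤ m) (b c k l : ℕ) (r s : Fin m) :
    bracket ((momentProduct n d b r)⁻¹ ^ k).trace ((momentProduct n d c s)⁻¹ ^ l).trace = 0 := by
  by_cases h : r = s
  · subst h
    -- Only the shorter product needs its invariants, so antisymmetry is used to put it in the first
    -- slot.
    wlog hbc : b ≤ c generalizing b c k l
    · rw [bracket_antisymm, this c b l k (by omega), neg_zero]
    rw [
      bracket_eq_trace bracket_antisymm (derivation_trace_momentProduct_inv_pow b k r)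
      (derivation_trace_momentProduct_inv_pow c l r)]
    refine (isNestedPair_momentProduct hm hbc r).trace_eq_zero (inCorner_embed _ _) ?_ _
    have hu := isUnit_det_momentProduct (n := n) (d := d) b r
    have hc : Commute ((momentProduct n d b r)⁻¹) (momentProduct n d b r) := by
      rw [Commute, SemiconjBy, Matrix.nonsing_inv_mul _ hu, Matrix.mul_nonsing_inv _ hu]
    rw [← embed_mul, ← embed_mul]
    exact congrArg _ ((hc.pow_left (k + 1)).smul_left (-(k : CoordRing n d))).eq
  · rw [bracket_eq_trace bracket_antisymm (derivation_trace_momentProduct_inv_pow b k r)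
      (derivation_trace_momentProduct_inv_pow c l s), matBracket_momentProduct_of_ne h]
    simp

theorem bracket_eq_zero_of_mem_Lplus (hm : 2 ≤ m) {f g : CoordRing n d} (hf : f ∈ Lplus n d)
    (hg : g ∈ Lplus n d) : bracket f g = 0 := by
  have h1 : ∀ k s b l t c, bracket ((Φ n d b s * (oneXY coord s)⁻¹) ^ k).trace
      ((Φ n d c t * (oneXY coord t)⁻¹) ^ l).trace = 0 := by
    intro k s b l t c
    rw [trace_Φ_pow, trace_Φ_pow]
    exact bracket_trace_momentProduct_inv_pow hm b c k l s t
  have h2 : ∀ k s b, bracket ((Φ n d b s * (oneXY coord s)⁻¹) ^ k).trace g = 0 := by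
    intro k s b
    -- A derivation that vanishes on generators vanishes on the algebra. This is applied in the
    -- second slot first, then in the other slot through antisymmetry.
    refine Derivation.eqOn_adjoin (D2 := 0) ?_ hg
    rintro _ ⟨l, t, c, -, rfl⟩
    exact h1 k s b l t c
  rw [bracket_antisymm, neg_eq_zero]
  refine Derivation.eqOn_adjoin (D2 := 0) ?_ hf
  rintro _ ⟨k, s, b, -, rfl⟩
  rw [bracket_antisymm, h2, neg_zero]
  rfl

theorem one_add_matXcyc_mul_matYcyc :
    1 + matXcyc n d * matYcyc n d = Matrix.blockDiagonal' (oneXY (coord (n := n) (d := d))) := by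
  have h1 : (1 : Matrix (Cyc n) (Cyc n) (CoordRing n d)) = ∑ s, proj n _ s := by
    rw [← Matrix.blockDiagonal'_one, ← sum_embed]
    exact Finset.sum_congr rfl fun s _ => embed_one s
  have h2 : matXcyc n d * matYcyc n d = ∑ s, matX coord s * matY coord s := by
    rw [matXcyc, matYcyc, Finset.sum_mul_sum]
    refine Finset.sum_congr rfl fun s _ => Finset.sum_eq_single_of_mem s (Finset.mem_univ s) ?_
    intro t _ ht
    -- The columns of `X_s` lie at `s + 1` and the rows of `Y_t` at `t + 1`, so mixed products
    -- vanish.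
    rw [← matX_mul_proj, ← proj_mul_matY, Matrix.mul_assoc,
      mul_mul_of_eq (proj_mul_proj_of_ne fun h => ht (add_right_cancel h).symm), Matrix.zero_mul,
      Matrix.mul_zero]
  rw [h1, h2, ← Finset.sum_add_distrib, ← sum_embed]
  exact Finset.sum_congr rfl fun s _ => (embed_oneXY s).symm

/-- All matrices involved are block diagonal, so each cyclic generator is the sum over `s` of
generators of `Lplus` with the same `k` and `b`. -/
theorem LplusCyc_le_Lplus : LplusCyc n d ≤ Lplus n d := by
  refine Algebra.adjoin_le ?_
  rintro _ ⟨k, b, hb, rfl⟩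
  have h : (Matrix.blockDiagonal' (oneXY (coord (n := n) (d := d))))⁻¹ =
      Matrix.blockDiagonal' fun s => (oneXY (coord (n := n) (d := d)) s)⁻¹ := by
    refine Matrix.inv_eq_right_inv ?_
    rw [← Matrix.blockDiagonal'_mul, ← Matrix.blockDiagonal'_one]
    congr 1
    ext1 s
    exact Matrix.mul_nonsing_inv _ (isUnit_det_oneXY s)
  rw [one_add_matXcyc_mul_matYcyc, h, Φcyc, ← Matrix.blockDiagonal'_mul,
    ← Matrix.blockDiagonal'_pow, Matrix.trace_blockDiagonal']
  exact Subalgebra.sum_mem _ fun s _ => Algebra.subset_adjoin ⟨k, s, b, hb, rfl⟩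

theorem isAbelianPoissonSubalgebra_of_bracket_eq_zero {L : Subalgebra ℂ (CoordRing n d)}
    (h : ∀ f ∈ L, ∀ g ∈ L, bracket f g = 0) : IsAbelianPoissonSubalgebra L where
  bracket_mem f hf g hg := by
    rw [h f hf g hg]
    exact L.zero_mem
  antisymm f _ g _ := bracket_antisymm f g
  jacobi f hf g hg k hk := by
    rw [h g hg k hk, h k hk f hf, h f hf g hg]
    simp
  abelian := h

end Generators

end CyclicQuiver

theorem proposition3p11 (m : ℕ) [NeZero m] (hm : 2 ≤ m) (n d : Fin m → ℕ) :
    CyclicQuiver.IsAbelianPoissonSubalgebra (CyclicQuiver.Lplus n d) ∧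
      CyclicQuiver.IsAbelianPoissonSubalgebra (CyclicQuiver.LplusCyc n d) :=
  ⟨CyclicQuiver.isAbelianPoissonSubalgebra_of_bracket_eq_zero fun _ hf _ hg =>
      CyclicQuiver.bracket_eq_zero_of_mem_Lplus hm hf hg,
    CyclicQuiver.isAbelianPoissonSubalgebra_of_bracket_eq_zero fun _ hf _ hg =>
      CyclicQuiver.bracket_eq_zero_of_mem_Lplus hm (CyclicQuiver.LplusCyc_le_Lplus hf)
        (CyclicQuiver.LplusCyc_le_Lplus hg)⟩
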